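/- All vector spaces are finite-dimensional complex inner product spaces. Let $D$ be a finite set, $\mathcal M=\mathcal M^{(1)}\oplus\dots\oplus\mathcal M^{(s)}$ and $\mathcal K$ vector spaces, and for $x\in D$ let $O_x=O_x^{(1)}\oplus\dots\oplus O_x^{(s)}$ be an input oracle with each $O_x^{(i)}$ a unitary on $\mathcal M^{(i)}$. (A single oracle is the case $s=1$.) The $O_x$ need not be distinct. *Notions.* A quantum query algorithm $\mathcal A$ in a space $\mathcal H\supseteq\mathcal K$ (with $\mathcal H$ of any finite dimension) maps an operator $O$ on $\mathcal M$ to $\mathcal A(O)=U_T\widetilde O U_{T-1}\widetilde O\cdots U_1\widetilde O U_0$, where the $U_t$ are unitaries on $\mathcal H$ independent of $O$, $\widetilde O=(O\otimes I)\oplus I$ with respect to some identification of $\mathcal H$ with $(\mathcal M\otimes\mathbb C^b)\oplus\mathbb C^c$. For $v\in\mathcal M\otimes\mathcal W$ write $v=\bigoplus_i v^{(i)}$ with $v^{(i)}\in\mathcal M^{(i)}\otimes\mathcal W$. If $\psi_t\in\mathcal M\otimes\mathbb C^b$ is the part of the state processed by $O\otimes I$ in the $t$-th query when $\mathcal A$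 is run on the oracle $O$ and the initial state $\xi$, the Las Vegas complexity is the vector $L(\mathcal A,O,\xi)\in\mathbb R^s$ with entries $L^{(i)}(\mathcal A,O,\xi)=\sum_{t=1}^T\|\psi_t^{(i)}\|^2$. **(1) State conversion.** Let $\xi_x,\tau_x\in\mathcal K$ $(x\in D)$ be such that, for every $O$, the vectors $\xi_x$ with $O_x=O$ are linearly independent; let $\mathcal K_O$ be their span. Let $(v_x)_{x\in D}$, $v_x\in\mathcal M\otimes\mathcal W$, satisfy $$\langle\xi_x,\xi_y\rangle-\langle\tau_x,\tau_y\rangle=\langle v_x,((I-O_x^*O_y)\otimes I_{\mathcal W})v_y\rangle\qquad\text{for all }x,y\in D.$$ Then there are linear maps $T_O\colon\mathcal K_O\to\mathcal K$ and $V_O\colon\mathcal K_O\to\mathcal M\otimes\mathcal W$ with $T_O\xi_x=\tau_x$ and $V_O\xi_x=v_x$ whenever $O_x=O$. For all such maps and every $\delta>0$ there is a quantum query algorithm $\mathcal A$ such that, for every $O$ and every $\xi\in\mathcal K_O$, $\mathcal A(O)\xi=T_O\xi$ and, for each $i$, $$\bigl|L^{(i)}(\mathcal A,O,\xi)-\|(V_O\xi)^{(i)}\|^2\bigr|\le\delta\|\xi\|^2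 .$$ **(2) Subspace conversion.** Let $T_x\colon\mathcal K_x\to\mathcal K$ be linear isometries on subspaces $\mathcal K_x\subseteq\mathcal K$ $(x\in D)$. An algorithm $\mathcal A$ solves the problem if $\mathcal A(O_x)$ agrees with $T_x$ on $\mathcal K_x$ for all $x$; its complexity profile is the vector in $\mathbb R^D\otimes\mathbb R^s$ whose $(x,i)$ entry is the supremum of $L^{(i)}(\mathcal A,O_x,\xi)$ over the unit vectors $\xi\in\mathcal K_x$ (and $0$ if $\mathcal K_x=0$). The feasible complexity space is the set of complexity profiles of all algorithms that solve the problem. A feasible solution of $\gamma_2(K_x^*K_y-T_x^*T_y\mid I-O_x^*O_y)_{x,y\in D}$, where $K_x\colon\mathcal K_x\to\mathcal K$ is the inclusion, consists of a space $\mathcal W$ and linear maps $V_x\colon\mathcal K_x\to\mathcal M\otimes\mathcal W$ with $$K_x^*K_y-T_x^*T_y=V_x^*((I-O_x^*O_y)\otimes I_{\mathcal W})V_y\qquad\text{for all }x,y\in D;$$ its objective profile is $(\|V_x^{(i)}\|^2)_{x,i}$ (operator norms). It is linearly consistent if, for each $O$, there is a linear map on $\operatorname{span}\bigcup_{x:\,O_x=O}\mathcal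 K_x$ that restricts to $V_x$ on $\mathcal K_x$ for every $x$ with $O_x=O$. Then the topological closure of the feasible complexity space equals the set of objective profiles of all linearly consistent feasible solutions. In particular, if the $O_x$ are pairwise distinct, it equals the feasible objective space, i.e. the set of objective profiles of all feasible solutions. -/

import Mathlib

open scoped InnerProductSpace

noncomputable section

namespace LasVegas

/-- The space `N ⊗ ℂ^w`, written as the direct sum of `w` copies of `N` (one for each vector of
the standard basis of `ℂ^w`). -/
abbrev Amp (N : Type*) (w : ℕ) : Type _ := PiLp 2 (fun _ : Fin w => N)

/-- The operator `A ⊗ I` on `N ⊗ ℂ^w`: it applies `A` to each of the `w` copies of `N`. -/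
def ampMap {N : Type*} [NormedAddCommGroup N] [InnerProductSpace ℂ N] (w : ℕ)
    (A : N →ₗ[ℂ] N) : Amp N w →ₗ[ℂ] Amp N w where
  toFun v := WithLp.toLp 2 (fun j => A (v j))
  map_add' u v := by ext j; simp
  map_smul' c v := by ext j; simp

section Oracles

variable {s : ℕ} {M : Fin s → Type*} [∀ i, NormedAddCommGroup (M i)]
  [∀ i, InnerProductSpace ℂ (M i)]

/-- The combined oracle `O⁽¹⁾ ⊕ ⋯ ⊕ O⁽ˢ⁾` on `M⁽¹⁾ ⊕ ⋯ ⊕ M⁽ˢ⁾`. -/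
def combined (O : ∀ i, M i →ₗ[ℂ] M i) : PiLp 2 M →ₗ[ℂ] PiLp 2 M where
  toFun v := WithLp.toLp 2 (fun i => O i (v i))
  map_add' u v := by ext i; simp
  map_smul' c v := by ext i; simp

/-- The component `v⁽ⁱ⁾ ∈ M⁽ⁱ⁾ ⊗ ℂ^w` of a vector `v ∈ (M⁽¹⁾ ⊕ ⋯ ⊕ M⁽ˢ⁾) ⊗ ℂ^w`. -/
def block (w : ℕ) (i : Fin s) : Amp (PiLp 2 M) w →ₗ[ℂ] Amp (M i) w where
  toFun v := WithLp.toLp 2 (fun j => v j i)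
  map_add' u v := by ext j; simp
  map_smul' c v := by ext j; simp

end Oracles

/-- A quantum query algorithm with work space `H` and input space `N`: unitaries `U_0, …, U_T` of
`H`, interleaved with `T` queries `(O ⊗ I_b) ⊕ I_c`, where `H` is identified with
`(N ⊗ ℂ^b) ⊕ ℂ^c` by the unitary `decomp`. The values of `U` beyond `T` play no role. -/
structure QueryAlgorithm (N H : Type*) [NormedAddCommGroup N] [InnerProductSpace ℂ N]
    [NormedAddCommGroup H] [InnerProductSpace ℂ H] where
  b : ℕ
  c : ℕ
  T : ℕ
  decomp : H ≃ₗᵢ[ℂ] WithLp 2 (Amp N b × EuclideanSpace ℂ (Fin c))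
  U : ℕ → (H ≃ₗᵢ[ℂ] H)

namespace QueryAlgorithm

variable {N H : Type*} [NormedAddCommGroup N] [InnerProductSpace ℂ N]
  [NormedAddCommGroup H] [InnerProductSpace ℂ H]

/-- The query `(O ⊗ I_b) ⊕ I_c` as an operator on the work space. -/
def query (A : QueryAlgorithm N H) (O : N →ₗ[ℂ] N) : H →ₗ[ℂ] H where
  toFun ψ := A.decomp.symm (WithLp.toLp 2 (ampMap A.b O (A.decomp ψ).fst, (A.decomp ψ).snd))
  map_add' u v := by
    rw [← map_add]
    congr 1
    simp [← WithLp.toLp_add]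
  map_smul' r u := by
    rw [RingHom.id_apply, ← map_smul]
    congr 1
    simp [← WithLp.toLp_smul]

/-- `U_t Õ U_{t-1} Õ ⋯ U_1 Õ U_0`: the state before query number `t + 1`. -/
def stateAt (A : QueryAlgorithm N H) (O : N →ₗ[ℂ] N) : ℕ → (H →ₗ[ℂ] H)
  | 0 => (A.U 0).toLinearEquiv.toLinearMap
  | t + 1 => (A.U (t + 1)).toLinearEquiv.toLinearMap ∘ₗ A.query O ∘ₗ A.stateAt O t

/-- The transformation `A(O) = U_T Õ U_{T-1} Õ ⋯ U_1 Õ U_0` performed by the algorithm. -/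
def run (A : QueryAlgorithm N H) (O : N →ₗ[ℂ] N) : H →ₗ[ℂ] H := A.stateAt O A.T

/-- The part in `N ⊗ ℂ^b` of the state before query number `t + 1`: what the oracle processes. -/
def queried (A : QueryAlgorithm N H) (O : N →ₗ[ℂ] N) (t : ℕ) (ψ : H) : Amp N A.b :=
  (A.decomp (A.stateAt O t ψ)).fst

/-- The Las Vegas complexity of the `i`-th input oracle: the sum over all `T` queries of the
squared norm of the state processed by that oracle. -/
def complexity {s : ℕ} {M : Fin s → Type*} [∀ i, NormedAddCommGroup (M i)]
    [∀ i, InnerProductSpace ℂ (M i)] (A : QueryAlgorithm (PiLp 2 M) H)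
    (O : ∀ i, M i →ₗ[ℂ] M i) (ψ : H) (i : Fin s) : ℝ :=
  ∑ t ∈ Finset.range A.T, ‖block A.b i (A.queried (combined O) t ψ)‖ ^ 2

end QueryAlgorithm

section GammaTwo

variable {D P : Type*} [NormedAddCommGroup P] [InnerProductSpace ℂ P]

/-- Feasibility of `(v_x)` for the unidirectional relative `γ₂` problem with scalar entries:
`e_{xy} = ⟨v_x, (Δ_{xy} ⊗ I) v_y⟩`. -/
def IsFeasibleVec (e : D → D → ℂ) (Δ : D → D → (P →ₗ[ℂ] P)) (w : ℕ) (v : D → Amp P w) : Prop :=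
  ∀ x y, e x y = ⟪v x, ampMap w (Δ x y) (v y)⟫_ℂ

/-- Feasibility of `(V_x)` for the unidirectional relative `γ₂` problem with operator entries:
`E_{xy} = V_x^* (Δ_{xy} ⊗ I) V_y`, where `V_x` is defined on `N_x` and `E_{xy} : N_y → N_x`. -/
def IsFeasible [FiniteDimensional ℂ P] {N : D → Type*} [∀ x, NormedAddCommGroup (N x)]
    [∀ x, InnerProductSpace ℂ (N x)] [∀ x, FiniteDimensional ℂ (N x)]
    (E : ∀ x y, N y →ₗ[ℂ] N x) (Δ : D → D → (P →ₗ[ℂ] P)) (w : ℕ)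
    (V : ∀ x, N x →ₗ[ℂ] Amp P w) : Prop :=
  ∀ x y, E x y = LinearMap.adjoint (V x) ∘ₗ ampMap w (Δ x y) ∘ₗ V y

/-- The entries `‖V_x⁽ⁱ⁾‖²` (operator norms) of the objective profile of `(V_x)`. -/
def objective {s : ℕ} {M : Fin s → Type*} [∀ i, NormedAddCommGroup (M i)]
    [∀ i, InnerProductSpace ℂ (M i)] {N : D → Type*} [∀ x, NormedAddCommGroup (N x)]
    [∀ x, InnerProductSpace ℂ (N x)] [∀ x, FiniteDimensional ℂ (N x)] {w : ℕ}
    (V : ∀ x, N x →ₗ[ℂ] Amp (PiLp 2 M) w) (x : D) (i : Fin s) : ℝ :=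
  ‖LinearMap.toContinuousLinearMap (block w i ∘ₗ V x)‖ ^ 2

end GammaTwo

section Problems

variable {D : Type*} {s : ℕ} {M : Fin s → Type*} [∀ i, NormedAddCommGroup (M i)]
  [∀ i, InnerProductSpace ℂ (M i)] {K : Type*} [NormedAddCommGroup K] [InnerProductSpace ℂ K]

/-- The family `I - O_x^* O_y`. -/
def oracleGap [∀ i, FiniteDimensional ℂ (M i)] (O : D → ∀ i, M i →ₗ[ℂ] M i) (x y : D) :
    PiLp 2 M →ₗ[ℂ] PiLp 2 M :=
  LinearMap.id - LinearMap.adjoint (combined (O x)) ∘ₗ combined (O y)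

/-! State conversion `ξ_x ↦ τ_x` -/

/-- The linear independence assumption: for each `Q`, the `ξ_x` with `O_x = Q` are linearly
independent. -/
def LinIndepAssumption (O : D → ∀ i, M i →ₗ[ℂ] M i) (ξ : D → K) : Prop :=
  ∀ Q : ∀ i, M i →ₗ[ℂ] M i, LinearIndependent ℂ (fun x : {x : D // O x = Q} => ξ x)

/-- The span `K_Q` of the `ξ_x` with `O_x = Q`. -/
def stateSpan (O : D → ∀ i, M i →ₗ[ℂ] M i) (ξ : D → K) (Q : ∀ i, M i →ₗ[ℂ] M i) :
    Submodule ℂ K :=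
  Submodule.span ℂ {u | ∃ x, O x = Q ∧ ξ x = u}

theorem mem_stateSpan (O : D → ∀ i, M i →ₗ[ℂ] M i) (ξ : D → K) (x : D) :
    ξ x ∈ stateSpan O ξ (O x) :=
  Submodule.subset_span ⟨x, rfl, rfl⟩

/-- The linear maps `L_Q`, defined on the spans `K_Q`, send `ξ_x` to `η_x` whenever `O_x = Q`. -/
def IsLinearExtension {E : Type*} [AddCommGroup E] [Module ℂ E] (O : D → ∀ i, M i →ₗ[ℂ] M i)
    (ξ : D → K) (η : D → E) (L : ∀ Q, stateSpan O ξ Q →ₗ[ℂ] E) : Prop :=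
  ∀ x, L (O x) ⟨ξ x, mem_stateSpan O ξ x⟩ = η x

/-- Feasibility for the adversary problem of state conversion,
`γ₂(⟨ξ_x, ξ_y⟩ - ⟨τ_x, τ_y⟩ | I - O_x^* O_y)`. -/
def AdversaryFeasible [∀ i, FiniteDimensional ℂ (M i)] (O : D → ∀ i, M i →ₗ[ℂ] M i)
    (ξ τ : D → K) (w : ℕ) (v : D → Amp (PiLp 2 M) w) : Prop :=
  IsFeasibleVec (fun x y => ⟪ξ x, ξ y⟫_ℂ - ⟪τ x, τ y⟫_ℂ) (oracleGap O) w v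

/-! Subspace conversion `T_x : K_x → K` -/

/-- The algorithm solves the subspace conversion problem: `A(O_x)` agrees with `T_x` on `K_x`,
where `K` is embedded into the work space by `J`. -/
def Solves {H : Type*} [NormedAddCommGroup H] [InnerProductSpace ℂ H]
    (A : QueryAlgorithm (PiLp 2 M) H) (J : K →ₗᵢ[ℂ] H) (O : D → ∀ i, M i →ₗ[ℂ] M i)
    (Ks : D → Submodule ℂ K) (T : ∀ x, Ks x →ₗ[ℂ] K) : Prop :=
  ∀ x (ξ : Ks x), A.run (combined (O x)) (J ξ) = J (T x ξ)

/-- The complexity profile: for each label `x` and each input oracle `i`, the supremum of the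
complexity over the unit vectors of `K_x` (it is `0` if there are none). -/
def profile {H : Type*} [NormedAddCommGroup H] [InnerProductSpace ℂ H]
    (A : QueryAlgorithm (PiLp 2 M) H) (J : K →ₗᵢ[ℂ] H) (O : D → ∀ i, M i →ₗ[ℂ] M i)
    (Ks : D → Submodule ℂ K) (x : D) (i : Fin s) : ℝ :=
  sSup {r : ℝ | ∃ ξ ∈ Ks x, ‖ξ‖ = 1 ∧ r = A.complexity (O x) (J ξ) i}

/-- The feasible complexity space: all complexity profiles of algorithms (with any
finite-dimensional work space) that solve the problem. -/
def complexitySpace (O : D → ∀ i, M i →ₗ[ℂ] M i) (Ks : D → Submodule ℂ K)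
    (T : ∀ x, Ks x →ₗ[ℂ] K) : Set (D → Fin s → ℝ) :=
  {p | ∃ (h : ℕ) (A : QueryAlgorithm (PiLp 2 M) (EuclideanSpace ℂ (Fin h)))
    (J : K →ₗᵢ[ℂ] EuclideanSpace ℂ (Fin h)), Solves A J O Ks T ∧ p = profile A J O Ks}

theorem mem_iSup_of_oracle_eq (O : D → ∀ i, M i →ₗ[ℂ] M i) (Ks : D → Submodule ℂ K)
    {Q : ∀ i, M i →ₗ[ℂ] M i} {x : D} (hx : O x = Q) (ξ : Ks x) :
    (ξ : K) ∈ ⨆ y : {y : D // O y = Q}, Ks y :=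
  Submodule.mem_iSup_of_mem (p := fun y : {y : D // O y = Q} => Ks y) ⟨x, hx⟩ ξ.2

variable [FiniteDimensional ℂ K]

/-- Feasibility of `V_x : K_x → (⨁ M⁽ⁱ⁾) ⊗ ℂ^w` for the adversary problem of subspace conversion,
`γ₂(K_x^* K_y - T_x^* T_y | I - O_x^* O_y)`. -/
def SubspaceFeasible [∀ i, FiniteDimensional ℂ (M i)] (O : D → ∀ i, M i →ₗ[ℂ] M i)
    (Ks : D → Submodule ℂ K) (T : ∀ x, Ks x →ₗ[ℂ] K) (w : ℕ)
    (V : ∀ x, Ks x →ₗ[ℂ] Amp (PiLp 2 M) w) : Prop :=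
  IsFeasible (fun x y => LinearMap.adjoint (Ks x).subtype ∘ₗ (Ks y).subtype -
    LinearMap.adjoint (T x) ∘ₗ T y) (oracleGap O) w V

/-- The feasible objective space: all objective profiles of feasible solutions. -/
def objectiveSpace [∀ i, FiniteDimensional ℂ (M i)] (O : D → ∀ i, M i →ₗ[ℂ] M i)
    (Ks : D → Submodule ℂ K) (T : ∀ x, Ks x →ₗ[ℂ] K) : Set (D → Fin s → ℝ) :=
  {p | ∃ (w : ℕ) (V : ∀ x, Ks x →ₗ[ℂ] Amp (PiLp 2 M) w),
    SubspaceFeasible O Ks T w V ∧ p = objective V}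

/-- Linear consistency of `(V_x)`: for each `Q` there is one linear map, on the span of the `K_x`
with `O_x = Q`, which restricts to `V_x` on each of these `K_x`. -/
def IsLinearlyConsistent (O : D → ∀ i, M i →ₗ[ℂ] M i) (Ks : D → Submodule ℂ K) {w : ℕ}
    (V : ∀ x, Ks x →ₗ[ℂ] Amp (PiLp 2 M) w) : Prop :=
  ∀ Q, ∃ VQ : ↥(⨆ y : {y : D // O y = Q}, Ks y) →ₗ[ℂ] Amp (PiLp 2 M) w,
    ∀ x (hx : O x = Q) (ξ : Ks x), VQ ⟨ξ, mem_iSup_of_oracle_eq O Ks hx ξ⟩ = V x ξ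

/-- All objective profiles of linearly consistent feasible solutions. -/
def consistentObjectiveSpace [∀ i, FiniteDimensional ℂ (M i)] (O : D → ∀ i, M i →ₗ[ℂ] M i)
    (Ks : D → Submodule ℂ K) (T : ∀ x, Ks x →ₗ[ℂ] K) : Set (D → Fin s → ℝ) :=
  {p | ∃ (w : ℕ) (V : ∀ x, Ks x →ₗ[ℂ] Amp (PiLp 2 M) w),
    SubspaceFeasible O Ks T w V ∧ IsLinearlyConsistent O Ks V ∧ p = objective V}

end Problems

end LasVegas

end

open LasVegas

/-! A family of states indexed by labels is determined by its Gram kernel up to a unitary that does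
not depend on the label. An algorithm is therefore a chain of kernel conversions: one query replaces
`gram V + R` by `gram (queryFamily q V) + R`, where `R` is the idle part, and the unitaries in
between are free (`Reach.exists_algorithm`).

In this language the adversary condition is `Catalyzes`: `ξ ⊕ v` and `τ ⊕ v` are linked by a single
query to `v`. Thus `v` is a catalyst that is returned intact, and the cost is exactly the squared
norms of its components. Splitting weight `1 - ε` of `ξ` into `n` equal portions lets one catalyst
of weight `c = (1 - ε) / n` serve them all, at total cost `(1 - ε)‖v‖²` in each component.

Exactness requires the catalyst to be produced and removed without error, and the remaining weight
`ε` of `ξ` pays for this. Finitely many unitaries can be discriminated exactly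
(`exists_reach_separating`), which kills the entries of `ε • gram ξ` between different oracles.
Since `v` depends linearly on `ξ` for each oracle, the resulting block-diagonal kernel dominates `c
• gram v` once `n` is large. Within a block `ξ` and `τ` have equal Gram kernels, so afterwards the
same kernel is a block-diagonal copy of `ε • gram τ`, and reversed discrimination merges it
(`exists_reach_merging`). The overhead is `O(ε)‖ξ‖²`; this is `Catalyzes.exists_reach`. Indexing by
all vectors of the initial spans, rather than a basis, makes the bound hold for every initial state.

For subspace conversion, the record of everything an algorithm queries is a linearly consistent
feasible solution with the same profile (`complexitySpace_subset`). Conversely, exact conversion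
approximates every consistent profile. The set of these profiles is closed, because solutions can be
compressed to a fixed dimension and are bounded by their objectives
(`isClosed_consistentObjectiveSpace`). -/

noncomputable section

namespace LasVegas

/-! ### Gram kernels -/

section Gram

variable {X E F : Type*} [NormedAddCommGroup E] [InnerProductSpace ℂ E]
  [NormedAddCommGroup F] [InnerProductSpace ℂ F]

/-- The Gram kernel of a family of vectors. -/
def gram (a : X → E) : X → X → ℂ := fun x y => ⟪a x, a y⟫_ℂ

/-- Kernels that are Gram kernels of families of vectors in finite-dimensional spaces. -/
def IsGram (G : X → X → ℂ) : Prop :=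
  ∃ (m : ℕ) (r : X → EuclideanSpace ℂ (Fin m)), gram r = G

theorem gram_apply (a : X → E) (x y : X) : gram a x y = ⟪a x, a y⟫_ℂ := rfl

theorem gram_comp_linearIsometry (a : X → E) (f : E →ₗᵢ[ℂ] F) :
    gram (fun x => f (a x)) = gram a := by
  ext x y; simp [gram]

theorem re_gram_self (a : X → E) (x : X) : (gram a x x).re = ‖a x‖ ^ 2 := by
  rw [gram_apply, inner_self_eq_norm_sq_to_K]
  norm_cast

theorem isGram_gram [FiniteDimensional ℂ E] (a : X → E) : IsGram (gram a) :=
  ⟨_, fun x => (stdOrthonormalBasis ℂ E).repr (a x), by ext x y; simp [gram]⟩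

theorem IsGram.add {G G' : X → X → ℂ} (h : IsGram G) (h' : IsGram G') : IsGram (G + G') := by
  obtain ⟨m, r, rfl⟩ := h
  obtain ⟨m', r', rfl⟩ := h'
  convert isGram_gram (fun x => WithLp.toLp 2 (r x, r' x)) using 1
  ext x y
  simp [gram]

theorem IsGram.smul {G : X → X → ℂ} (h : IsGram G) {c : ℝ} (hc : 0 ≤ c) :
    IsGram ((c : ℂ) • G) := by
  obtain ⟨m, r, rfl⟩ := h
  convert isGram_gram (fun x => ((Real.sqrt c : ℝ) : ℂ) • r x) using 1
  ext x y
  simp only [gram, Pi.smul_apply, inner_smul_left, inner_smul_right, smul_eq_mul,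
    Complex.conj_ofReal, ← mul_assoc]
  norm_cast
  rw [Real.mul_self_sqrt hc]

theorem IsGram.mul {G G' : X → X → ℂ} (h : IsGram G) (h' : IsGram G') : IsGram (G * G') := by
  obtain ⟨m, r, rfl⟩ := h
  obtain ⟨m', r', rfl⟩ := h'
  convert isGram_gram (E := EuclideanSpace ℂ (Fin m × Fin m'))
    (fun x => WithLp.toLp 2 fun p => r x p.1 * r' x p.2) using 1
  ext x y
  simp only [gram, Pi.mul_apply, PiLp.inner_apply, RCLike.inner_apply, Fintype.sum_prod_type,
    Finset.sum_mul_sum, map_mul]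
  exact Finset.sum_congr rfl fun _ _ => Finset.sum_congr rfl fun _ _ => by ring

theorem isGram_zero : IsGram (0 : X → X → ℂ) := by
  convert isGram_gram (fun _ : X => (0 : EuclideanSpace ℂ (Fin 0))) using 1
  ext x y; simp [gram]

theorem isGram_one : IsGram (1 : X → X → ℂ) := by
  convert isGram_gram (fun _ : X => (1 : ℂ)) using 1
  ext x y; simp [gram]

theorem IsGram.nsmul {G : X → X → ℂ} (h : IsGram G) (n : ℕ) : IsGram (n • G) := by
  induction n with
  | zero => simpa using isGram_zero
  | succ n ih => rw [succ_nsmul]; exact ih.add h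

theorem IsGram.re_nonneg {G : X → X → ℂ} (h : IsGram G) (x : X) : 0 ≤ (G x x).re := by
  obtain ⟨m, r, rfl⟩ := h
  rw [re_gram_self]; positivity

/-- A linear map into a finite-dimensional space that has the same norms as another one is
obtained from it by a unitary. -/
theorem exists_unitary_comp_eq [FiniteDimensional ℂ E] {Z : Type*} [AddCommGroup Z] [Module ℂ Z]
    (f g : Z →ₗ[ℂ] E) (h : ∀ z, ‖f z‖ = ‖g z‖) : ∃ U : E ≃ₗᵢ[ℂ] E, ∀ z, U (f z) = g z := by
  obtain ⟨σ, hσ⟩ := f.rangeRestrict.exists_rightInverse_of_surjective f.range_rangeRestrict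
  have hσ' : ∀ r : LinearMap.range f, f (σ r) = r := fun r =>
    congrArg Subtype.val (LinearMap.congr_fun hσ r)
  let L : LinearMap.range f →ₗᵢ[ℂ] E :=
    { toLinearMap := g ∘ₗ σ
      norm_map' := fun r => by
        rw [LinearMap.comp_apply, ← h, hσ']; rfl }
  refine ⟨L.extend.toLinearIsometryEquiv rfl, fun z => ?_⟩
  rw [LinearIsometry.toLinearIsometryEquiv_apply]
  have h1 := L.extend_apply (f.rangeRestrict z)
  refine h1.trans ?_
  change g (σ (f.rangeRestrict z)) = g z
  -- Equal norms give `f` and `g` the same kernel, which contains the difference of `σ (f z)` and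
  -- `z`.
  rw [← sub_eq_zero, ← map_sub, ← norm_eq_zero, ← h, map_sub, hσ']
  simp

/-- The norm of a finite linear combination depends only on the Gram kernel, so `X` may be infinite.
-/
theorem exists_unitary_of_gram_eq [FiniteDimensional ℂ E] (a b : X → E) (h : gram a = gram b) :
    ∃ U : E ≃ₗᵢ[ℂ] E, ∀ x, U (a x) = b x := by
  obtain ⟨U, hU⟩ := exists_unitary_comp_eq (Finsupp.linearCombination ℂ a)
    (Finsupp.linearCombination ℂ b) (fun z => by
      have : ∀ a : X → E, ‖Finsupp.linearCombination ℂ a z‖ ^ 2 =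
          (z.sum fun x c => z.sum fun y d => d * ((starRingEnd ℂ) c * gram a x y)).re := by
        intro a
        rw [← inner_self_eq_norm_sq (𝕜 := ℂ), Finsupp.linearCombination_apply, Finsupp.sum_inner]
        simp only [Finsupp.sum, inner_smul_left, inner_sum, inner_smul_right, gram]
        rfl
      rw [← sq_eq_sq₀ (norm_nonneg _) (norm_nonneg _), this, this, h])
  exact ⟨U, fun x => by simpa using hU (Finsupp.single x 1)⟩

end Gram

/-! ### Conversions of Gram kernels by queries -/

section Reach

variable {s : ℕ} {M : Fin s → Type*} [∀ i, NormedAddCommGroup (M i)]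
  [∀ i, InnerProductSpace ℂ (M i)] {X : Type*}

theorem inner_amp {N : Type*} [NormedAddCommGroup N] [InnerProductSpace ℂ N] {w : ℕ}
    (u v : Amp N w) : ⟪u, v⟫_ℂ = ∑ j, ⟪u j, v j⟫_ℂ := PiLp.inner_apply _ _

@[simp] theorem ampMap_apply {N : Type*} [NormedAddCommGroup N] [InnerProductSpace ℂ N] {w : ℕ}
    (A : N →ₗ[ℂ] N) (v : Amp N w) (j : Fin w) : ampMap w A v j = A (v j) := rfl

@[simp] theorem block_apply {w : ℕ} (i : Fin s) (v : Amp (PiLp 2 M) w) (j : Fin w) :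
    block w i v j = v j i := rfl

theorem norm_sq_amp {N : Type*} [NormedAddCommGroup N] [InnerProductSpace ℂ N] {w : ℕ}
    (v : Amp N w) : ‖v‖ ^ 2 = ∑ j, ‖v j‖ ^ 2 := PiLp.norm_sq_eq_of_L2 _ _

/-- The families to which the query is applied: `x` is processed by the oracle `q x`. -/
def queryFamily (q : X → (PiLp 2 M ≃ₗᵢ[ℂ] PiLp 2 M)) {w : ℕ} (V : X → Amp (PiLp 2 M) w) :
    X → Amp (PiLp 2 M) w :=
  fun x => ampMap w (q x).toLinearEquiv.toLinearMap (V x)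

/-- One query converts the Gram kernel `E` into the Gram kernel `F`, at cost `κ`. -/
def Step (q : X → (PiLp 2 M ≃ₗᵢ[ℂ] PiLp 2 M)) (E F : X → X → ℂ) (κ : X → Fin s → ℝ) : Prop :=
  ∃ (w : ℕ) (V : X → Amp (PiLp 2 M) w) (R : X → X → ℂ), IsGram R ∧ E = gram V + R ∧
    F = gram (queryFamily q V) + R ∧ ∀ x i, κ x i = ‖block w i (V x)‖ ^ 2

/-- A sequence of queries converts the Gram kernel `E` into the Gram kernel `F`, at total
cost `κ`. -/
inductive Reach (q : X → (PiLp 2 M ≃ₗᵢ[ℂ] PiLp 2 M)) :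
    (X → X → ℂ) → (X → X → ℂ) → (X → Fin s → ℝ) → Prop
  | refl (E : X → X → ℂ) : Reach q E E 0
  | head {E F G : X → X → ℂ} {κ κ' : X → Fin s → ℝ} :
      Step q E F κ → Reach q F G κ' → Reach q E G (κ + κ')

variable {q : X → (PiLp 2 M ≃ₗᵢ[ℂ] PiLp 2 M)} {E F G E' F' : X → X → ℂ} {κ κ' : X → Fin s → ℝ}

theorem norm_sq_block_le {w : ℕ} (i : Fin s) (v : Amp (PiLp 2 M) w) :
    ‖block w i v‖ ^ 2 ≤ ‖v‖ ^ 2 := by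
  rw [norm_sq_amp, norm_sq_amp]
  refine Finset.sum_le_sum fun j _ => ?_
  rw [block_apply]
  gcongr
  exact PiLp.norm_apply_le (v j) i

theorem Step.add (h : Step q E F κ) (hG : IsGram G) : Step q (E + G) (F + G) κ := by
  obtain ⟨w, V, R, hR, rfl, rfl, hκ⟩ := h
  exact ⟨w, V, R + G, hR.add hG, add_assoc _ _ _, add_assoc _ _ _, hκ⟩

/-- Tensoring with an idle register in state `g x` multiplies Gram kernels entrywise and scales the
cost by `‖g x‖²`. -/
theorem Step.mul (h : Step q E F κ) (hG : IsGram G) :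
    Step q (G * E) (G * F) (fun x i => (G x x).re * κ x i) := by
  obtain ⟨w, V, R, hR, rfl, rfl, hκ⟩ := h
  obtain ⟨m, g, rfl⟩ := hG
  refine ⟨w * m, fun x => WithLp.toLp 2 fun p =>
    g x (finProdFinEquiv.symm p).2 • V x (finProdFinEquiv.symm p).1, gram g * R,
    (isGram_gram g).mul hR, ?_, ?_, fun x i => ?_⟩
  · ext x y
    simp only [gram, Pi.mul_apply, Pi.add_apply, mul_add, inner_amp, add_left_inj]
    rw [finProdFinEquiv.symm.sum_comp
      (fun p : Fin w × Fin m => ⟪g x p.2 • V x p.1, g y p.2 • V y p.1⟫_ℂ)]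
    simp only [Fintype.sum_prod_type_right, PiLp.inner_apply, Finset.sum_mul_sum,
      inner_smul_left, inner_smul_right, RCLike.inner_apply]
    exact Finset.sum_congr rfl fun _ _ => Finset.sum_congr rfl fun _ _ => by ring
  · ext x y
    simp only [gram, queryFamily, Pi.mul_apply, Pi.add_apply, mul_add, inner_amp, add_left_inj,
      ampMap_apply, map_smul]
    rw [finProdFinEquiv.symm.sum_comp
      (fun p : Fin w × Fin m => ⟪g x p.2 • (q x).toLinearEquiv.toLinearMap (V x p.1),
        g y p.2 • (q y).toLinearEquiv.toLinearMap (V y p.1)⟫_ℂ)]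
    simp only [Fintype.sum_prod_type_right, PiLp.inner_apply, Finset.sum_mul_sum,
      inner_smul_left, inner_smul_right, RCLike.inner_apply]
    exact Finset.sum_congr rfl fun _ _ => Finset.sum_congr rfl fun _ _ => by ring
  · beta_reduce
    rw [hκ, re_gram_self]
    simp only [norm_sq_amp, block_apply, PiLp.smul_apply]
    rw [finProdFinEquiv.symm.sum_comp
      (fun p : Fin w × Fin m => ‖g x p.2 • V x p.1 i‖ ^ 2)]
    simp only [Fintype.sum_prod_type_right, Finset.sum_mul_sum,
      norm_smul, mul_pow]

theorem gram_queryFamily_self {w : ℕ} (V : X → Amp (PiLp 2 M) w) (x : X) :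
    gram (queryFamily q V) x x = gram V x x := by
  rw [gram, gram, inner_amp, inner_amp]
  exact Finset.sum_congr rfl fun j _ => (q x).inner_map_map _ _

theorem queryFamily_inv {w : ℕ} (V : X → Amp (PiLp 2 M) w) :
    queryFamily q⁻¹ (queryFamily q V) = V := by
  ext x j : 2
  exact (q x).symm_apply_apply (V x j)

/-- Conversions run backwards against the inverse oracles. The new cost need not be tracked, since
`Reach.exists_cost_le` bounds any cost. -/
theorem Step.symm (h : Step q E F κ) : ∃ κ', Step q⁻¹ F E κ' := by
  obtain ⟨w, V, R, hR, rfl, rfl, hκ⟩ := h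
  exact ⟨_, w, queryFamily q V, R, hR, rfl, by rw [queryFamily_inv], fun _ _ => rfl⟩

theorem Step.diag (h : Step q E F κ) (x : X) : F x x = E x x := by
  obtain ⟨w, V, R, hR, rfl, rfl, hκ⟩ := h
  simp [gram_queryFamily_self]

theorem Step.cost_le (h : Step q E F κ) (x : X) (i : Fin s) : κ x i ≤ (E x x).re := by
  obtain ⟨w, V, R, hR, rfl, rfl, hκ⟩ := h
  rw [hκ, Pi.add_apply, Pi.add_apply, Complex.add_re, re_gram_self]
  linarith [hR.re_nonneg x, norm_sq_block_le i (V x)]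

theorem Step.cost_nonneg (h : Step q E F κ) (x : X) (i : Fin s) : 0 ≤ κ x i := by
  obtain ⟨w, V, R, hR, rfl, rfl, hκ⟩ := h
  rw [hκ]; positivity

theorem Step.reach (h : Step q E F κ) : Reach q E F κ := by
  simpa using Reach.head h (Reach.refl F)

theorem Reach.trans (h : Reach q E F κ) (h' : Reach q F G κ') : Reach q E G (κ + κ') := by
  induction h with
  | refl => simpa using h'
  | head h1 _ ih => rw [add_assoc]; exact Reach.head h1 (ih h')

theorem Reach.add_right (h : Reach q E F κ) (hG : IsGram G) : Reach q (E + G) (F + G) κ := by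
  induction h with
  | refl => exact Reach.refl _
  | head h1 _ ih => exact Reach.head (h1.add hG) ih

theorem Reach.add (h : Reach q E F κ) (h' : Reach q E' F' κ') (hF : IsGram F) (hE' : IsGram E') :
    Reach q (E + E') (F + F') (κ + κ') := by
  refine (h.add_right hE').trans ?_
  rw [add_comm F E', add_comm F F']
  exact h'.add_right hF

theorem Reach.mul_left (h : Reach q E F κ) (hG : IsGram G) :
    Reach q (G * E) (G * F) (fun x i => (G x x).re * κ x i) := by
  induction h with
  | refl =>
    convert Reach.refl (q := q) _ using 1
    ext x i; simp
  | head h1 _ ih =>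
    convert Reach.head (h1.mul hG) ih using 1
    ext x i; simp [mul_add]

theorem Reach.smul (h : Reach q E F κ) {c : ℝ} (hc : 0 ≤ c) :
    Reach q ((c : ℂ) • E) ((c : ℂ) • F) (c • κ) := by
  convert h.mul_left (isGram_one.smul hc) using 1 <;> ext <;> simp

theorem Reach.symm (h : Reach q E F κ) : ∃ κ', Reach q⁻¹ F E κ' := by
  induction h with
  | refl E => exact ⟨0, Reach.refl E⟩
  | head h1 _ ih =>
    obtain ⟨κ₁, h1'⟩ := h1.symm
    obtain ⟨κ₂, h2'⟩ := ih
    exact ⟨_, h2'.trans h1'.reach⟩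

theorem Reach.cost_nonneg (h : Reach q E F κ) (x : X) (i : Fin s) : 0 ≤ κ x i := by
  induction h with
  | refl E => exact le_rfl
  | head h1 _ ih => exact add_nonneg (h1.cost_nonneg x i) ih

/-- Queries preserve the diagonal of the kernel, and one query costs at most the diagonal entry; `n`
counts the queries. -/
theorem Reach.exists_cost_le (h : Reach q E F κ) :
    ∃ n : ℕ, ∀ x i, κ x i ≤ n * (E x x).re := by
  induction h with
  | refl E => exact ⟨0, by simp⟩
  | head h1 _ ih =>
    obtain ⟨n, hn⟩ := ih
    refine ⟨n + 1, fun x i => ?_⟩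
    have h2 := hn x i
    have h3 := h1.cost_le x i
    rw [h1.diag] at h2
    push_cast
    rw [Pi.add_apply, Pi.add_apply]
    linarith

/-- A catalyst can be used any number of times. -/
theorem Step.reach_nsmul (h : Step q (E + G) (F + G) κ) (hE : IsGram E) (hF : IsGram F) (n : ℕ) :
    Reach q (n • E + G) (n • F + G) (n • κ) := by
  induction n with
  | zero => simpa using Reach.refl (q := q) G
  | succ n ih =>
    rw [succ_nsmul κ]
    -- The earlier uses leave one copy of `E` idle and return `G`, which then converts this last
    -- copy.
    have h1 : Reach q ((n + 1) • E + G) (n • F + E + G) (n • κ) := by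
      convert ih.add_right hE using 1
      · rw [succ_nsmul]; abel
      · abel
    refine h1.trans ?_
    convert h.reach.add_right (hF.nsmul n) using 1
    · abel
    · rw [succ_nsmul]; abel

end Reach


/-! ### Exact discrimination of oracles -/

/-- For `z ≠ 1` on the unit circle, `0` is a convex combination of `1` and two successive powers
of `z`. -/
theorem exists_convex_combination_pow_eq_zero {z : ℂ} (hz : ‖z‖ = 1) (hz1 : z ≠ 1) :
    ∃ (c₀ c₁ c₂ : ℝ) (n : ℕ), 0 ≤ c₀ ∧ 0 ≤ c₁ ∧ 0 ≤ c₂ ∧ c₀ + c₁ + c₂ = 1 ∧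
      (c₀ : ℂ) + c₁ * z ^ n + c₂ * z ^ (n + 1) = 0 := by
  have main : ∀ z : ℂ, ‖z‖ = 1 → 0 < z.im →
      ∃ (c₀ c₁ c₂ : ℝ) (n : ℕ), 0 ≤ c₀ ∧ 0 ≤ c₁ ∧ 0 ≤ c₂ ∧ c₀ + c₁ + c₂ = 1 ∧
        (c₀ : ℂ) + c₁ * z ^ n + c₂ * z ^ (n + 1) = 0 := by
    intro z hz him
    -- The first multiple of `z.arg` to reach `π` lies below `π + z.arg ≤ 2π`, so its sine is
    -- nonpositive.
    have hex : ∃ k : ℕ, (z ^ (k + 1)).im ≤ 0 := by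
      have harg : 0 < z.arg := by
        rcases (Complex.arg_nonneg_iff.2 him.le).lt_or_eq with h | h
        · exact h
        · exact absurd (Complex.arg_eq_zero_iff.1 h.symm).2 him.ne'
      have harg' : z.arg ≤ Real.pi := Complex.arg_le_pi z
      have hzexp : z = Complex.exp (z.arg * Complex.I) := by
        conv_lhs => rw [← Complex.norm_mul_exp_arg_mul_I z, hz]
        simp
      have him' : ∀ k : ℕ, (z ^ k).im = Real.sin (k * z.arg) := by
        intro k
        conv_lhs => rw [hzexp, ← Complex.exp_nat_mul]
        rw [show (k : ℂ) * (z.arg * Complex.I) = ((k * z.arg : ℝ) : ℂ) * Complex.I by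
          push_cast; ring, Complex.exp_ofReal_mul_I_im]
      obtain ⟨k, hk⟩ : ∃ k, ⌈Real.pi / z.arg⌉₊ = k + 1 :=
        Nat.exists_eq_succ_of_ne_zero (Nat.ceil_pos.2 (div_pos Real.pi_pos harg)).ne'
      refine ⟨k, ?_⟩
      rw [him', ← hk]
      have h1 : Real.pi ≤ ⌈Real.pi / z.arg⌉₊ * z.arg := by
        rw [← div_le_iff₀ harg]; exact Nat.le_ceil _
      have h2 : ⌈Real.pi / z.arg⌉₊ * z.arg < Real.pi + z.arg := by
        have := Nat.ceil_lt_add_one (div_pos Real.pi_pos harg).le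
        calc _ < (Real.pi / z.arg + 1) * z.arg := by gcongr
          _ = _ := by field_simp
      rw [← neg_neg (Real.sin _), ← Real.sin_sub_pi]
      have := Real.sin_nonneg_of_nonneg_of_le_pi (sub_nonneg.2 h1) (by linarith)
      linarith
    classical
    let k := Nat.find hex
    have hk : (z ^ (k + 1)).im ≤ 0 := Nat.find_spec hex
    have hk' : 0 ≤ (z ^ k).im := by
      rcases Nat.eq_zero_or_pos k with h | h
      · simp [h]
      · obtain ⟨j, hj⟩ : ∃ j, k = j + 1 := Nat.exists_eq_succ_of_ne_zero h.ne'
        have := Nat.find_min hex (m := j) (by change j < k; omega)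
        rw [hj]
        exact (not_le.1 this).le
    -- This is the planar identity `[b,c]a + [c,a]b + [a,b]c = 0` for `a = 1`, `b = z ^ k`, `c = z ^
    -- (k + 1)`. The minimality of `k` makes all three coefficients nonnegative.
    have hid : (z.im : ℂ) + ((-(z ^ (k + 1)).im : ℝ) : ℂ) * z ^ k
        + ((z ^ k).im : ℂ) * z ^ (k + 1) = 0 := by
      have hnk : Complex.normSq (z ^ k) = 1 := by
        rw [Complex.normSq_eq_norm_sq, norm_pow, hz]; simp
      rw [Complex.normSq_apply] at hnk
      rw [pow_succ]
      apply Complex.ext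
      · simp only [Complex.add_re, Complex.mul_re, Complex.ofReal_re, Complex.ofReal_im,
          Complex.mul_im, Complex.zero_re]
        linear_combination (-z.im) * hnk
      · simp only [Complex.add_im, Complex.mul_re, Complex.ofReal_re, Complex.ofReal_im,
          Complex.mul_im, Complex.zero_im]
        ring
    set S := z.im + -(z ^ (k + 1)).im + (z ^ k).im with hS
    have hSpos : 0 < S := by linarith
    refine ⟨z.im / S, -(z ^ (k + 1)).im / S, (z ^ k).im / S, k, by positivity,
      div_nonneg (by linarith) hSpos.le, div_nonneg hk' hSpos.le, ?_, ?_⟩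
    · rw [← add_div, ← add_div, ← hS, div_self hSpos.ne']
    · have hS' : (S : ℂ) ≠ 0 := by exact_mod_cast hSpos.ne'
      simp only [Complex.ofReal_div]
      rw [div_mul_eq_mul_div, div_mul_eq_mul_div, ← add_div, ← add_div, hid, zero_div]
  rcases lt_trichotomy z.im 0 with h | h | h
  · obtain ⟨c₀, c₁, c₂, n, h0, h1, h2, hs, he⟩ := main ((starRingEnd ℂ) z) (by simpa using hz)
      (by simpa using h)
    refine ⟨c₀, c₁, c₂, n, h0, h1, h2, hs, ?_⟩
    have := congrArg (starRingEnd ℂ) he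
    simpa using this
  · have hre : z.re * z.re = 1 := by
      have := Complex.normSq_eq_norm_sq z
      rw [Complex.normSq_apply, h, hz] at this
      linarith
    have : z = -1 := by
      rcases mul_self_eq_one_iff.1 hre with h' | h'
      · exact absurd (Complex.ext h' h) hz1
      · exact Complex.ext (by simpa using h') (by simpa using h)
    refine ⟨1 / 2, 0, 1 / 2, 0, by norm_num, le_rfl, by norm_num, by norm_num, ?_⟩
    rw [this]; norm_num
  · exact main z hz h

/-- The orthogonal complement of the fixed space is invariant and nonzero, so it contains an
eigenvector, and this cannot be fixed. -/
theorem exists_eigenvector_ne_one {N : Type*} [NormedAddCommGroup N]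
    [InnerProductSpace ℂ N] [FiniteDimensional ℂ N] (U : N ≃ₗᵢ[ℂ] N) (hU : U ≠ 1) :
    ∃ (a : N) (z : ℂ), ‖a‖ = 1 ∧ ‖z‖ = 1 ∧ z ≠ 1 ∧ U a = z • a := by
  let f : N →ₗ[ℂ] N := U.toLinearEquiv.toLinearMap
  have hf : ∀ v, f v = U v := fun _ => rfl
  let W : Submodule ℂ N := (Module.End.eigenspace f 1)ᗮ
  have hW : ∀ v ∈ W, f v ∈ W := by
    intro v hv
    rw [Submodule.mem_orthogonal] at hv ⊢
    intro u hu
    have h1 : f u = u := by simpa using Module.End.mem_eigenspace_iff.1 hu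
    rw [← h1, hf, hf, U.inner_map_map]
    exact hv u hu
  have hne : W ≠ ⊥ := by
    intro h
    rw [Submodule.orthogonal_eq_bot_iff] at h
    apply hU
    ext v
    have : v ∈ Module.End.eigenspace f 1 := h ▸ Submodule.mem_top
    simpa [hf] using Module.End.mem_eigenspace_iff.1 this
  have : Nontrivial W := Submodule.nontrivial_iff_ne_bot.2 hne
  obtain ⟨z, hz⟩ := Module.End.exists_eigenvalue (f.restrict hW)
  obtain ⟨b, hb⟩ := hz.exists_hasEigenvector
  have hb1 : U b = z • (b : N) := congrArg Subtype.val hb.apply_eq_smul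
  have hb0 : (b : N) ≠ 0 := fun h => hb.2 (Subtype.ext h)
  have hn : ‖(b : N)‖ ≠ 0 := norm_ne_zero_iff.2 hb0
  refine ⟨((‖(b : N)‖⁻¹ : ℝ) : ℂ) • (b : N), z, ?_, ?_, ?_, ?_⟩
  · rw [norm_smul]; simp [hn]
  · have := congrArg norm hb1
    rw [U.norm_map, norm_smul] at this
    exact mul_right_cancel₀ hn (by rw [← this, one_mul])
  · rintro rfl
    apply hb0
    rw [← inner_self_eq_zero (𝕜 := ℂ)]
    refine (Submodule.mem_orthogonal _ _).1 b.2 _ (Module.End.mem_eigenspace_iff.2 ?_)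
    exact hb1
  · rw [map_smul, hb1, smul_comm]

section Discrimination

variable {s : ℕ} {M : Fin s → Type*} [∀ i, NormedAddCommGroup (M i)]
  [∀ i, InnerProductSpace ℂ (M i)] {X : Type*}
  {q : X → (PiLp 2 M ≃ₗᵢ[ℂ] PiLp 2 M)}

/-- Each factor costs one query: `P⁻¹` is the same for all labels and leaves the Gram kernel
unchanged. -/
theorem reach_gram_pow (q : X → (PiLp 2 M ≃ₗᵢ[ℂ] PiLp 2 M)) (P : PiLp 2 M ≃ₗᵢ[ℂ] PiLp 2 M)
    {a : PiLp 2 M} (ha : ‖a‖ = 1) (n : ℕ) :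
    ∃ κ, Reach q 1 (gram fun x => ((P⁻¹ * q x) ^ n) a) κ := by
  induction n with
  | zero =>
    refine ⟨0, ?_⟩
    convert Reach.refl (q := q) 1 using 1
    ext x y
    simp [gram, ha]
  | succ n ih =>
    obtain ⟨κ, h⟩ := ih
    have hs : Step q (gram fun x => ((P⁻¹ * q x) ^ n) a) (gram fun x => ((P⁻¹ * q x) ^ (n + 1)) a)
        (fun x i => ‖block 1 i (WithLp.toLp 2 fun _ => ((P⁻¹ * q x) ^ n) a)‖ ^ 2) := by
      refine ⟨1, fun x => WithLp.toLp 2 fun _ => ((P⁻¹ * q x) ^ n) a, 0, isGram_zero, ?_, ?_,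
        fun _ _ => rfl⟩
      · ext x y
        simp [gram, inner_amp]
      · ext x y
        simp only [gram, add_zero, queryFamily, inner_amp, ampMap_apply, Finset.univ_unique,
          Finset.sum_singleton, pow_succ']
        exact (P⁻¹).inner_map_map _ _
    exact ⟨_, h.trans hs.reach⟩

/-- Two distinct oracles can be discriminated exactly. -/
theorem exists_reach_separating_pair [∀ i, FiniteDimensional ℂ (M i)]
    (q : X → (PiLp 2 M ≃ₗᵢ[ℂ] PiLp 2 M))
    {P Q : PiLp 2 M ≃ₗᵢ[ℂ] PiLp 2 M} (hPQ : P ≠ Q) :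
    ∃ g κ, Reach q 1 g κ ∧ IsGram g ∧ (∀ x y, q x = q y → g x y = 1) ∧
      ∀ x y, q x = P → q y = Q → g x y = 0 := by
  obtain ⟨a, z, ha, hz, hz1, haz⟩ := exists_eigenvector_ne_one (P⁻¹ * Q)
    (fun h => hPQ (inv_mul_eq_one.1 h))
  obtain ⟨c₀, c₁, c₂, n, h0, h1, h2, hs, he⟩ := exists_convex_combination_pow_eq_zero hz hz1
  let G : ℕ → X → X → ℂ := fun k => gram fun x => ((P⁻¹ * q x) ^ k) a
  have hG : ∀ k, IsGram (G k) := fun k => isGram_gram _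
  obtain ⟨κ₁, r₁⟩ := reach_gram_pow q P ha n
  obtain ⟨κ₂, r₂⟩ := reach_gram_pow q P ha (n + 1)
  have hsum : (c₀ : ℂ) + c₁ + c₂ = 1 := by exact_mod_cast hs
  have hdiag : ∀ k x y, q x = q y → G k x y = 1 := by
    intro k x y hxy
    simp only [G, gram, hxy, LinearIsometryEquiv.inner_map_map]
    rw [inner_self_eq_norm_sq_to_K, ha]; simp
  refine ⟨(c₀ : ℂ) • 1 + (c₁ : ℂ) • G n + (c₂ : ℂ) • G (n + 1),
    0 + c₁ • κ₁ + c₂ • κ₂, ?_,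
    ((isGram_one.smul h0).add ((hG n).smul h1)).add ((hG _).smul h2), ?_, ?_⟩
  -- The three powers are prepared in orthogonal branches with weights `c₀`, `c₁`, `c₂`. Between `P`
  -- and `Q` the branches contribute powers of `z`, which cancel.
  · convert ((Reach.refl (q := q) ((c₀ : ℂ) • 1)).add (r₁.smul h1) (isGram_one.smul h0)
      (isGram_one.smul h1)).add (r₂.smul h2) ((isGram_one.smul h0).add ((hG n).smul h1))
      (isGram_one.smul h2) using 1
    rw [← add_smul, ← add_smul, hsum, one_smul]
  · intro x y hxy
    simp [hdiag _ x y hxy, hsum]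
  · intro x y hx hy
    have hP : ∀ k, ((P⁻¹ * q x) ^ k) a = a := by simp [hx]
    have hQ : ∀ k, ((P⁻¹ * q y) ^ k) a = z ^ k • a := by
      intro k
      rw [hy]
      induction k with
      | zero => simp
      | succ k ih =>
        rw [pow_succ' (P⁻¹ * Q), LinearIsometryEquiv.coe_mul, Function.comp_apply, ih, map_smul, haz, smul_smul,
          pow_succ]
    have hGk : ∀ k, G k x y = z ^ k := by
      intro k
      simp only [G, gram]
      rw [hP, hQ, inner_smul_right, inner_self_eq_norm_sq_to_K, ha]
      simp
    simp [hGk, he]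

open Classical in
/-- Finitely many distinct oracles can be discriminated exactly. -/
theorem exists_reach_separating [∀ i, FiniteDimensional ℂ (M i)]
    (hq : (Set.range q).Finite) :
    ∃ κ, Reach q 1 (fun x y => if q x = q y then 1 else 0) κ := by
  have key : ∀ t : Finset ((PiLp 2 M ≃ₗᵢ[ℂ] PiLp 2 M) × (PiLp 2 M ≃ₗᵢ[ℂ] PiLp 2 M)),
      ∃ g κ, Reach q 1 g κ ∧ IsGram g ∧ (∀ x y, q x = q y → g x y = 1) ∧
        ∀ p ∈ t, p.1 ≠ p.2 → ∀ x y, q x = p.1 → q y = p.2 → g x y = 0 := by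
    intro t
    induction t using Finset.induction_on with
    | empty => exact ⟨1, 0, Reach.refl 1, isGram_one, fun _ _ _ => rfl, by simp⟩
    | insert p t _ ih =>
      obtain ⟨g, κ, r, hg, h1, h0⟩ := ih
      by_cases hp : p.1 = p.2
      · refine ⟨g, κ, r, hg, h1, fun p' hp' hne => ?_⟩
        rcases Finset.mem_insert.1 hp' with rfl | h
        · exact absurd hp hne
        · exact h0 p' h hne
      · obtain ⟨g', κ', r', hg', h1', h0'⟩ := exists_reach_separating_pair q hp
        -- Keeping the earlier states beside the new ones multiplies the kernels, so zeros
        -- accumulate while ones survive.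
        have hr : Reach q g (g * g') (fun x i => (g x x).re * κ' x i) := by
          simpa using r'.mul_left hg
        refine ⟨g * g', _, r.trans hr, hg.mul hg', ?_, ?_⟩
        · intro x y hxy
          simp [h1 x y hxy, h1' x y hxy]
        · intro p' hp' hne x y hx hy
          rcases Finset.mem_insert.1 hp' with rfl | h
          · simp [h0' x y hx hy]
          · simp [h0 p' h hne x y hx hy]
  obtain ⟨g, κ, r, hg, h1, h0⟩ := key (hq.toFinset ×ˢ hq.toFinset)
  refine ⟨κ, ?_⟩
  convert r using 1
  ext x y
  split_ifs with h
  · exact (h1 x y h).symm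
  · exact (h0 (q x, q y) (by simp) h x y rfl rfl).symm

-- Separation for the inverse oracles, run backwards; inversion does not change which oracles
-- coincide.
open Classical in
theorem exists_reach_merging [∀ i, FiniteDimensional ℂ (M i)] (hq : (Set.range q).Finite) :
    ∃ κ, Reach q (fun x y => if q x = q y then 1 else 0) 1 κ := by
  have hq' : (Set.range q⁻¹).Finite := by
    refine (hq.image (·⁻¹)).subset ?_
    rintro _ ⟨x, rfl⟩
    exact ⟨q x, ⟨x, rfl⟩, rfl⟩
  obtain ⟨κ, h⟩ := exists_reach_separating hq'
  obtain ⟨κ', h'⟩ := h.symm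
  refine ⟨κ', ?_⟩
  simpa using h'

end Discrimination


/-! ### Exact state conversion in terms of Gram kernels -/

/-- A multiple of the identity dominates a sufficiently small multiple of `A^* A`. -/
theorem exists_inner_sub_eq {Z E : Type*} [NormedAddCommGroup Z] [InnerProductSpace ℂ Z]
    [FiniteDimensional ℂ Z] [NormedAddCommGroup E] [InnerProductSpace ℂ E]
    [FiniteDimensional ℂ E] (A : Z →ₗ[ℂ] E) {ε c : ℝ}
    (h : ∀ z, c * ‖A z‖ ^ 2 ≤ ε * ‖z‖ ^ 2) :
    ∃ B : Z →L[ℂ] Z, ∀ z z', (ε : ℂ) * ⟪z, z'⟫_ℂ = c * ⟪A z, A z'⟫_ℂ + ⟪B z, B z'⟫_ℂ := by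
  have := FiniteDimensional.complete ℂ Z
  let T : Z →ₗ[ℂ] Z := (ε : ℂ) • LinearMap.id - (c : ℂ) • (LinearMap.adjoint A ∘ₗ A)
  have hT : ∀ z z', ⟪z, T z'⟫_ℂ = ε * ⟪z, z'⟫_ℂ - c * ⟪A z, A z'⟫_ℂ := by
    intro z z'
    simp only [T, LinearMap.sub_apply, LinearMap.smul_apply, LinearMap.id_apply,
      LinearMap.comp_apply, inner_sub_right, inner_smul_right, LinearMap.adjoint_inner_right]
  have hT' : ∀ z z', ⟪T z, z'⟫_ℂ = ε * ⟪z, z'⟫_ℂ - c * ⟪A z, A z'⟫_ℂ := by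
    intro z z'
    rw [← inner_conj_symm, hT]
    simp
  have hpos : 0 ≤ LinearMap.toContinuousLinearMap T := by
    rw [ContinuousLinearMap.nonneg_iff_isPositive, ContinuousLinearMap.isPositive_def]
    refine ⟨fun z z' => ?_, fun z => ?_⟩
    · change ⟪T z, z'⟫_ℂ = ⟪z, T z'⟫_ℂ
      rw [hT, hT']
    · rw [ContinuousLinearMap.reApplyInnerSelf_apply]
      change 0 ≤ RCLike.re ⟪T z, z⟫_ℂ
      rw [hT', inner_self_eq_norm_sq_to_K, inner_self_eq_norm_sq_to_K]
      have : (ε : ℂ) * ((‖z‖ : ℝ) : ℂ) ^ 2 - c * ((‖A z‖ : ℝ) : ℂ) ^ 2 =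
        ((ε * ‖z‖ ^ 2 - c * ‖A z‖ ^ 2 : ℝ) : ℂ) := by push_cast; ring
      change 0 ≤ ((ε : ℂ) * ((‖z‖ : ℝ) : ℂ) ^ 2 - c * ((‖A z‖ : ℝ) : ℂ) ^ 2).re
      rw [this, Complex.ofReal_re]
      linarith [h z]
  -- The factor `B` of the positive operator `ε - c A^* A` realizes the remainder as a Gram kernel.
  obtain ⟨B, hB⟩ := CStarAlgebra.nonneg_iff_eq_star_mul_self.1 hpos
  refine ⟨B, fun z z' => ?_⟩
  have h1 : ⟪B z, B z'⟫_ℂ = ⟪z, T z'⟫_ℂ := by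
    have : T z' = (star B * B) z' := by rw [← hB]; rfl
    rw [this, mul_apply_eq_comp, ContinuousLinearMap.star_eq_adjoint,
      ContinuousLinearMap.adjoint_inner_right]
  rw [h1, hT]
  ring

section Conversion

variable {s : ℕ} {M : Fin s → Type*} [∀ i, NormedAddCommGroup (M i)]
  [∀ i, InnerProductSpace ℂ (M i)] [∀ i, FiniteDimensional ℂ (M i)] {X : Type*}
  {K : Type*} [NormedAddCommGroup K] [InnerProductSpace ℂ K] [FiniteDimensional ℂ K]
  {q : X → (PiLp 2 M ≃ₗᵢ[ℂ] PiLp 2 M)}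

/-- The kernel identity that the adversary problem requires: one catalytic query with catalyst
`v` turns `ξ` into `τ`. -/
def Catalyzes (q : X → (PiLp 2 M ≃ₗᵢ[ℂ] PiLp 2 M)) (ξ τ : X → K) {w : ℕ}
    (v : X → Amp (PiLp 2 M) w) : Prop :=
  gram ξ + gram (queryFamily q v) = gram τ + gram v

-- Only the part `v` is queried while `ξ` stays idle, so the cost comes from the catalyst alone.
-- Weight `c` amounts to scaling all vectors by `√c`.
omit [∀ i, FiniteDimensional ℂ (M i)] in
theorem Catalyzes.step {ξ τ : X → K} {w : ℕ} {v : X → Amp (PiLp 2 M) w}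
    (h : Catalyzes q ξ τ v) {c : ℝ} (hc : 0 ≤ c) :
    Step q ((c : ℂ) • gram ξ + (c : ℂ) • gram v) ((c : ℂ) • gram τ + (c : ℂ) • gram v)
      (fun x i => c * ‖block w i (v x)‖ ^ 2) := by
  have hsc : ∀ f : X → Amp (PiLp 2 M) w, gram (fun x => ((Real.sqrt c : ℝ) : ℂ) • f x) =
      (c : ℂ) • gram f := by
    intro f
    ext x y
    simp only [gram, Pi.smul_apply, inner_smul_left, inner_smul_right, smul_eq_mul,
      Complex.conj_ofReal, ← mul_assoc]
    norm_cast
    rw [Real.mul_self_sqrt hc]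
  refine ⟨w, fun x => ((Real.sqrt c : ℝ) : ℂ) • v x, (c : ℂ) • gram ξ,
    (isGram_gram ξ).smul hc, ?_, ?_, fun x i => ?_⟩
  · rw [hsc, add_comm]
  · have : queryFamily q (fun x => ((Real.sqrt c : ℝ) : ℂ) • v x) =
        fun x => ((Real.sqrt c : ℝ) : ℂ) • queryFamily q v x := by
      ext x : 1; simp [queryFamily]
    rw [this, hsc, ← smul_add, ← smul_add, ← h, add_comm]
  · rw [map_smul, norm_smul, mul_pow, Complex.norm_real, Real.norm_eq_abs, sq_abs, Real.sq_sqrt hc]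

-- A common unitary preserves the inner products of `v`, so the catalyst terms cancel.
omit [∀ i, FiniteDimensional ℂ (M i)] [FiniteDimensional ℂ K] in
theorem Catalyzes.gram_eq {ξ τ : X → K} {w : ℕ} {v : X → Amp (PiLp 2 M) w}
    (h : Catalyzes q ξ τ v) {x y : X} (hxy : q x = q y) : gram ξ x y = gram τ x y := by
  have h1 : gram (queryFamily q v) x y = gram v x y := by
    simp only [gram, queryFamily, inner_amp, ampMap_apply, hxy]
    exact Finset.sum_congr rfl fun j _ => (q y).inner_map_map _ _
  have h2 := congrFun (congrFun h x) y
  rw [Pi.add_apply, Pi.add_apply, Pi.add_apply, Pi.add_apply, h1] at h2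
  exact add_right_cancel h2

/-- Here `S` lists the distinct oracles. Linearity of `v` in `ξ` for each of them is what lets a
small part of `ξ` contain the catalyst. -/
theorem Catalyzes.exists_reach {S : Type*} [Finite S] (o : X → S)
    (u : S → (PiLp 2 M ≃ₗᵢ[ℂ] PiLp 2 M)) (hu : Function.Injective u) {ξ τ : X → K} {w : ℕ}
    {v : X → Amp (PiLp 2 M) w} (h : Catalyzes (fun x => u (o x)) ξ τ v)
    (L : S → K →ₗ[ℂ] Amp (PiLp 2 M) w) (hL : ∀ x, L (o x) (ξ x) = v x) {δ : ℝ} (hδ : 0 < δ) :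
    ∃ κ, Reach (fun x => u (o x)) (gram ξ) (gram τ) κ ∧
      ∀ x i, |κ x i - ‖block w i (v x)‖ ^ 2| ≤ δ * ‖ξ x‖ ^ 2 := by
  classical
  have := Fintype.ofFinite S
  set q : X → (PiLp 2 M ≃ₗᵢ[ℂ] PiLp 2 M) := fun x => u (o x) with hqdef
  have hq : (Set.range q).Finite := (Set.finite_range u).subset (by rintro _ ⟨x, rfl⟩; exact ⟨_, rfl⟩)
  obtain ⟨κ₁, r₁⟩ := exists_reach_separating hq
  obtain ⟨κ₂, r₂⟩ := exists_reach_merging hq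
  obtain ⟨n₁, hn₁⟩ := r₁.exists_cost_le
  obtain ⟨n₂, hn₂⟩ := r₂.exists_cost_le
  -- Both initial kernels are `1` on the diagonal, so these costs are bounded uniformly over the
  -- possibly infinite `X`.
  simp only [if_true, Pi.one_apply, Complex.one_re, mul_one] at hn₁ hn₂
  -- the direct sum of the copies of `K` and the joint linear map
  let Z := PiLp 2 (fun _ : S => K)
  let A : Z →ₗ[ℂ] Amp (PiLp 2 M) w := ∑ j, L j ∘ₗ (PiLp.projₗ 2 (fun _ : S => K) j)
  -- Placing `ξ x` in the copy of its own oracle realizes the block-diagonal part of `gram ξ`.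
  let ι : X → Z := fun x => WithLp.toLp 2 fun j => if o x = j then ξ x else 0
  have hA : ∀ x, A (ι x) = v x := by
    intro x
    simp only [A, LinearMap.sum_apply, LinearMap.comp_apply]
    change ∑ j, L j (if o x = j then ξ x else 0) = v x
    simp only [apply_ite, map_zero, Finset.sum_ite_eq, Finset.mem_univ, if_true, hL]
  have hι : ∀ x y, ⟪ι x, ι y⟫_ℂ = if q x = q y then ⟪ξ x, ξ y⟫_ℂ else 0 := by
    intro x y
    have hxy : q x = q y ↔ o x = o y := hu.eq_iff
    rw [PiLp.inner_apply]
    change ∑ j, ⟪if o x = j then ξ x else 0, if o y = j then ξ y else 0⟫_ℂ = _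
    rw [Finset.sum_eq_single (o x) (fun j _ hj => by simp [hj.symm]) (by simp)]
    simp only [hxy, if_true, eq_comm (a := o y)]
    split_ifs <;> simp
  obtain ⟨C, hC0, hC⟩ : ∃ C : ℝ, 0 ≤ C ∧ ∀ z, ‖A z‖ ^ 2 ≤ C * ‖z‖ ^ 2 := by
    refine ⟨‖LinearMap.toContinuousLinearMap A‖ ^ 2, by positivity, fun z => ?_⟩
    rw [← mul_pow]
    gcongr
    exact (LinearMap.toContinuousLinearMap A).le_opNorm z
  have hvC : ∀ x i, ‖block w i (v x)‖ ^ 2 ≤ C * ‖ξ x‖ ^ 2 := by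
    intro x i
    refine (norm_sq_block_le i (v x)).trans ?_
    rw [← hA]
    refine (hC _).trans_eq ?_
    rw [← re_gram_self ι, gram_apply, hι, if_pos rfl, ← gram_apply, re_gram_self]
  have hnorm : ∀ x, ‖τ x‖ ^ 2 = ‖ξ x‖ ^ 2 := by
    intro x
    rw [← re_gram_self, ← re_gram_self, h.gram_eq rfl]
  set Ctot : ℝ := n₁ + n₂ + C + 1 with hCtot
  have hCpos : 0 < Ctot := by positivity
  set ε : ℝ := min (1 / 2) (δ / Ctot) with hε
  have hε0 : 0 < ε := by positivity
  have hε1 : ε ≤ 1 / 2 := min_le_left _ _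
  have hεδ : ε * Ctot ≤ δ := by
    rw [← le_div_iff₀ hCpos]; exact min_le_right _ _
  -- This makes `c * C ≤ ε`, so weight `ε` of the separated states dominates the catalyst of weight
  -- `c`.
  obtain ⟨n, hn⟩ := exists_nat_gt (C / ε)
  have hn0 : (0 : ℝ) < n := (div_nonneg hC0 hε0.le).trans_lt hn
  set c : ℝ := (1 - ε) / n with hc
  have hc0 : 0 ≤ c := div_nonneg (by linarith) hn0.le
  have hnc : n * c = 1 - ε := by rw [hc]; field_simp
  obtain ⟨B, hB⟩ := exists_inner_sub_eq A (ε := ε) (c := c) (fun z => by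
    have h1 : c * C ≤ ε := by
      rw [div_lt_iff₀ hε0] at hn
      have : n * (c * C) ≤ n * ε := by
        rw [← mul_assoc, hnc]; nlinarith
      exact le_of_mul_le_mul_left this hn0
    calc c * ‖A z‖ ^ 2 ≤ c * (C * ‖z‖ ^ 2) := by gcongr; exact hC z
      _ = c * C * ‖z‖ ^ 2 := by ring
      _ ≤ ε * ‖z‖ ^ 2 := by gcongr)
  let δK : X → X → ℂ := fun x y => if q x = q y then 1 else 0
  let R : X → X → ℂ := gram fun x => B (ι x)
  have hR : IsGram R := isGram_gram _
  have hξ := isGram_gram ξ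
  have hτ := isGram_gram τ
  have hsplit : (ε : ℂ) • gram ξ * δK = (c : ℂ) • gram v + R := by
    ext x y
    have := hB (ι x) (ι y)
    rw [hι, hA, hA] at this
    simp only [Pi.mul_apply, Pi.smul_apply, Pi.add_apply, gram, smul_eq_mul, R, δK, ← this]
    split_ifs <;> simp
  have hswap : (ε : ℂ) • gram τ * δK = (ε : ℂ) • gram ξ * δK := by
    ext x y
    simp only [Pi.mul_apply, Pi.smul_apply, δK]
    split_ifs with hxy
    · rw [h.gram_eq hxy]
    · simp
  have hone : ∀ f : X → X → ℂ, ((1 - ε : ℝ) : ℂ) • f + (ε : ℂ) • f = f := by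
    intro f
    rw [← add_smul]; push_cast; simp
  have hncs : ∀ f : X → X → ℂ, n • ((c : ℂ) • f) = ((1 - ε : ℝ) : ℂ) • f := by
    intro f
    rw [← hnc, ← Nat.cast_smul_eq_nsmul ℂ, smul_smul]; push_cast; rfl
  have hG1 : IsGram (((1 - ε : ℝ) : ℂ) • gram ξ) := hξ.smul (by linarith)
  have hG2 : IsGram (((1 - ε : ℝ) : ℂ) • gram τ) := hτ.smul (by linarith)
  -- The three stages create the catalyst with remainder `R`, use it `n` times, and merge the blocks
  -- back.
  have s₁ := (r₁.mul_left (hξ.smul hε0.le)).add_right hG1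
  have s₂ := (((h.step hc0).reach_nsmul (hξ.smul hc0) (hτ.smul hc0) n)).add_right hR
  have s₃ := (r₂.mul_left (hτ.smul hε0.le)).add_right hG2
  rw [mul_one, add_comm, hone, hsplit, add_comm] at s₁
  rw [hncs, hncs, add_assoc, add_assoc] at s₂
  rw [mul_one, add_comm ((ε : ℂ) • gram τ), hone, hswap, hsplit, add_comm] at s₃
  refine ⟨_, s₁.trans (s₂.trans s₃), fun x i => ?_⟩
  simp only [Pi.add_apply, Pi.smul_apply, smul_eq_mul, Complex.re_ofReal_mul, re_gram_self, hnorm]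
  rw [nsmul_eq_mul, ← mul_assoc (n : ℝ), hnc]
  have a1 := hn₁ x i
  have a2 := hn₂ x i
  have b1 := r₁.cost_nonneg x i
  have b2 := r₂.cost_nonneg x i
  have a3 := hvC x i
  set V2 := ‖block w i (v x)‖ ^ 2 with hV2
  have b3 : 0 ≤ V2 := by positivity
  have hxx : 0 ≤ ε * ‖ξ x‖ ^ 2 := by positivity
  have d1 : ε * ‖ξ x‖ ^ 2 * κ₁ x i ≤ ε * ‖ξ x‖ ^ 2 * n₁ := mul_le_mul_of_nonneg_left a1 hxx
  have d2 : ε * ‖ξ x‖ ^ 2 * κ₂ x i ≤ ε * ‖ξ x‖ ^ 2 * n₂ := mul_le_mul_of_nonneg_left a2 hxx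
  have e1 : 0 ≤ ε * ‖ξ x‖ ^ 2 * κ₁ x i := mul_nonneg hxx b1
  have e2 : 0 ≤ ε * ‖ξ x‖ ^ 2 * κ₂ x i := mul_nonneg hxx b2
  have d3 : ε * V2 ≤ ε * (C * ‖ξ x‖ ^ 2) := mul_le_mul_of_nonneg_left a3 hε0.le
  have e3 : 0 ≤ ε * V2 := mul_nonneg hε0.le b3
  have hfin : ε * Ctot * ‖ξ x‖ ^ 2 ≤ δ * ‖ξ x‖ ^ 2 := by gcongr
  have hexp : ε * Ctot * ‖ξ x‖ ^ 2 = ε * ‖ξ x‖ ^ 2 * n₁ + ε * ‖ξ x‖ ^ 2 * n₂ +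
      ε * (C * ‖ξ x‖ ^ 2) + ε * ‖ξ x‖ ^ 2 := by rw [hCtot]; ring
  have hC1 : 0 ≤ ε * (C * ‖ξ x‖ ^ 2) := e3.trans d3
  rw [abs_le]
  constructor <;> linarith

end Conversion


/-! ### From sequences of Gram kernels to query algorithms -/

/-- The embedding of `N ⊗ ℂ^w` into `N ⊗ ℂ^b` for `w ≤ b`. -/
def pad {N : Type*} [NormedAddCommGroup N] [InnerProductSpace ℂ N] {w b : ℕ} (h : w ≤ b) :
    Amp N w →ₗᵢ[ℂ] Amp N b where
  toFun v := WithLp.toLp 2 fun k => if hk : (k : ℕ) < w then v ⟨k, hk⟩ else 0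
  map_add' u v := by
    ext k
    by_cases hk : (k : ℕ) < w <;> simp [hk]
  map_smul' c v := by
    ext k
    by_cases hk : (k : ℕ) < w <;> simp [hk]
  norm_map' v := by
    rw [← sq_eq_sq₀ (norm_nonneg _) (norm_nonneg _), norm_sq_amp, norm_sq_amp]
    refine (Fintype.sum_of_injective (Fin.castLE h) (Fin.castLE_injective h) _ _ ?_ ?_).symm
    · intro k hk
      have : ¬ (k : ℕ) < w := fun hlt => hk ⟨⟨k, hlt⟩, rfl⟩
      simp [this]
    · intro j
      simp

theorem pad_apply {N : Type*} [NormedAddCommGroup N] [InnerProductSpace ℂ N] {w b : ℕ}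
    (h : w ≤ b) (v : Amp N w) (k : Fin b) :
    pad h v k = if hk : (k : ℕ) < w then v ⟨k, hk⟩ else 0 := rfl

theorem ampMap_pad {N : Type*} [NormedAddCommGroup N] [InnerProductSpace ℂ N] {w b : ℕ}
    (h : w ≤ b) (A : N →ₗ[ℂ] N) (v : Amp N w) : ampMap b A (pad h v) = pad h (ampMap w A v) := by
  ext k
  by_cases hk : (k : ℕ) < w <;> simp [pad_apply, hk]

/-- The isometric inclusion of the second summand of an orthogonal direct sum. -/
def inrIsometry (E F : Type*) [NormedAddCommGroup E] [InnerProductSpace ℂ E]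
    [NormedAddCommGroup F] [InnerProductSpace ℂ F] : F →ₗᵢ[ℂ] WithLp 2 (E × F) where
  toFun v := WithLp.toLp 2 (0, v)
  map_add' u v := by rw [← WithLp.toLp_add]; simp
  map_smul' c v := by rw [← WithLp.toLp_smul]; simp
  norm_map' v := by simp

section Synthesis

variable {s : ℕ} {M : Fin s → Type*} [∀ i, NormedAddCommGroup (M i)]
  [∀ i, InnerProductSpace ℂ (M i)]

theorem block_pad {w b : ℕ} (h : w ≤ b) (i : Fin s) (v : Amp (PiLp 2 M) w) :
    block b i (pad h v) = pad h (block w i v) := by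
  ext k
  by_cases hk : (k : ℕ) < w <;> simp [pad_apply, hk]

variable {X : Type*} {q : X → (PiLp 2 M ≃ₗᵢ[ℂ] PiLp 2 M)}

/-- The algorithm which applies `U₀` and a query before it runs `A`. -/
def QueryAlgorithm.prepend {N H : Type*} [NormedAddCommGroup N] [InnerProductSpace ℂ N]
    [NormedAddCommGroup H] [InnerProductSpace ℂ H] (A : QueryAlgorithm N H) (U₀ : H ≃ₗᵢ[ℂ] H) :
    QueryAlgorithm N H where
  b := A.b
  c := A.c
  T := A.T + 1
  decomp := A.decomp
  U t := match t with
    | 0 => U₀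
    | t + 1 => A.U t

theorem QueryAlgorithm.stateAt_prepend {N H : Type*} [NormedAddCommGroup N]
    [InnerProductSpace ℂ N] [NormedAddCommGroup H] [InnerProductSpace ℂ H]
    (A : QueryAlgorithm N H) (U₀ : H ≃ₗᵢ[ℂ] H) (O : N →ₗ[ℂ] N) (t : ℕ) (ψ : H) :
    (A.prepend U₀).stateAt O (t + 1) ψ = A.stateAt O t (A.query O (U₀ ψ)) := by
  induction t with
  | zero => rfl
  | succ t ih =>
    change A.U (t + 1) (A.query O ((A.prepend U₀).stateAt O (t + 1) ψ)) = _
    rw [ih]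
    rfl

/-- The oracle `q x` as a linear map. -/
abbrev oracleMap (q : X → (PiLp 2 M ≃ₗᵢ[ℂ] PiLp 2 M)) (x : X) : PiLp 2 M →ₗ[ℂ] PiLp 2 M :=
  (q x).toLinearEquiv.toLinearMap

/-- Equal Gram kernels supply the unitary before each query. All steps must share one work space, so
the induction needs arbitrary large registers and a prescribed `decomp`. -/
theorem Reach.exists_algorithm {E F : X → X → ℂ} {κ : X → Fin s → ℝ} (h : Reach q E F κ) :
    ∃ b₀ c₀ : ℕ, ∀ b c, b₀ ≤ b → c₀ ≤ c → ∀ (d : ℕ)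
      (decomp : EuclideanSpace ℂ (Fin d) ≃ₗᵢ[ℂ]
        WithLp 2 (Amp (PiLp 2 M) b × EuclideanSpace ℂ (Fin c)))
      (e f : X → EuclideanSpace ℂ (Fin d)), gram e = E → gram f = F →
      ∃ A : QueryAlgorithm (PiLp 2 M) (EuclideanSpace ℂ (Fin d)),
        (∃ hb : A.b = b, ∃ hc : A.c = c, hb ▸ hc ▸ A.decomp = decomp) ∧
        (∀ x, A.run (oracleMap q x) (e x) = f x) ∧
        ∀ x i, ∑ t ∈ Finset.range A.T,
          ‖block A.b i (A.queried (oracleMap q x) t (e x))‖ ^ 2 = κ x i := by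
  induction h with
  | refl E =>
    refine ⟨0, 0, fun b c _ _ d decomp e f he hf => ?_⟩
    obtain ⟨U, hU⟩ := exists_unitary_of_gram_eq e f (he.trans hf.symm)
    exact ⟨⟨b, c, 0, decomp, fun _ => U⟩, ⟨rfl, rfl, rfl⟩, hU, fun x i => by simp⟩
  | @head E F G κ κ' hstep _ ih =>
    obtain ⟨w, V, R, ⟨m, r, rfl⟩, rfl, rfl, hκ⟩ := hstep
    obtain ⟨b₀, c₀, ih⟩ := ih
    refine ⟨max b₀ w, max c₀ m, fun b c hb hc d decomp e f he hf => ?_⟩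
    have hw : w ≤ b := (le_max_right _ _).trans hb
    have hm : m ≤ c := (le_max_right _ _).trans hc
    let e₁ : X → EuclideanSpace ℂ (Fin d) := fun x =>
      decomp.symm (WithLp.toLp 2 (pad hw (V x), pad hm (r x)))
    let e₂ : X → EuclideanSpace ℂ (Fin d) := fun x =>
      decomp.symm (WithLp.toLp 2 (pad hw (queryFamily q V x), pad hm (r x)))
    have h₁ : gram e₁ = gram V + gram r := by
      ext x y
      simp [e₁, gram]
    have h₂ : gram e₂ = gram (queryFamily q V) + gram r := by
      ext x y
      simp [e₂, gram]
    obtain ⟨U₀, hU₀⟩ := exists_unitary_of_gram_eq e e₁ (he.trans h₁.symm)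
    obtain ⟨A, ⟨rfl, rfl, hd⟩, hrun, hcost⟩ := ih b c ((le_max_left _ _).trans hb)
      ((le_max_left _ _).trans hc) d decomp e₂ f h₂ hf
    subst hd
    have hquery : ∀ x, A.query (oracleMap q x) (U₀ (e x)) = e₂ x := by
      intro x
      rw [hU₀]
      change A.decomp.symm (WithLp.toLp 2 (ampMap A.b (oracleMap q x) (A.decomp (e₁ x)).fst,
        (A.decomp (e₁ x)).snd)) = _
      have : A.decomp (e₁ x) = WithLp.toLp 2 (pad hw (V x), pad hm (r x)) :=
        A.decomp.apply_symm_apply _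
      rw [this]
      change A.decomp.symm (WithLp.toLp 2 (ampMap A.b (oracleMap q x) (pad hw (V x)),
        pad hm (r x))) = _
      rw [ampMap_pad]
      rfl
    refine ⟨A.prepend U₀, ⟨rfl, rfl, rfl⟩, fun x => ?_, fun x i => ?_⟩
    · change (A.prepend U₀).stateAt _ (A.T + 1) _ = _
      rw [A.stateAt_prepend, hquery]
      exact hrun x
    · change ∑ t ∈ Finset.range (A.T + 1), ‖block A.b i
        (A.decomp ((A.prepend U₀).stateAt (oracleMap q x) t (e x))).fst‖ ^ 2 = _
      rw [Finset.sum_range_succ']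
      simp only [A.stateAt_prepend, hquery]
      rw [Pi.add_apply, Pi.add_apply, ← hcost, hκ, add_comm]
      congr 1
      change ‖block A.b i (A.decomp (U₀ (e x))).fst‖ ^ 2 = _
      rw [hU₀]
      have : A.decomp (e₁ x) = WithLp.toLp 2 (pad hw (V x), pad hm (r x)) :=
        A.decomp.apply_symm_apply _
      rw [this]
      change ‖block A.b i (pad hw (V x))‖ ^ 2 = _
      rw [block_pad, LinearIsometry.norm_map]

variable [∀ i, FiniteDimensional ℂ (M i)]
  {K : Type*} [NormedAddCommGroup K] [InnerProductSpace ℂ K] [FiniteDimensional ℂ K]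

theorem Catalyzes.exists_algorithm {S : Type*} [Finite S] (o : X → S)
    (u : S → (PiLp 2 M ≃ₗᵢ[ℂ] PiLp 2 M)) (hu : Function.Injective u) {ξ τ : X → K} {w : ℕ}
    {v : X → Amp (PiLp 2 M) w} (h : Catalyzes (fun x => u (o x)) ξ τ v)
    (L : S → K →ₗ[ℂ] Amp (PiLp 2 M) w) (hL : ∀ x, L (o x) (ξ x) = v x) {δ : ℝ} (hδ : 0 < δ) :
    ∃ (d : ℕ) (A : QueryAlgorithm (PiLp 2 M) (EuclideanSpace ℂ (Fin d)))
      (J : K →ₗᵢ[ℂ] EuclideanSpace ℂ (Fin d)),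
      ∀ x, A.run (oracleMap u (o x)) (J (ξ x)) = J (τ x) ∧
        ∀ i, |∑ t ∈ Finset.range A.T,
            ‖block A.b i (A.queried (oracleMap u (o x)) t (J (ξ x)))‖ ^ 2 -
          ‖block w i (v x)‖ ^ 2| ≤ δ * ‖ξ x‖ ^ 2 := by
  obtain ⟨κ, r, hκ⟩ := h.exists_reach o u hu L hL hδ
  obtain ⟨b, c₀, halg⟩ := r.exists_algorithm
  let k := Module.finrank ℂ K
  -- The idle register is enlarged to hold an isometric copy of `K`.
  let c := max c₀ k
  let H := WithLp 2 (Amp (PiLp 2 M) b × EuclideanSpace ℂ (Fin c))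
  let decomp := (stdOrthonormalBasis ℂ H).repr.symm
  let J : K →ₗᵢ[ℂ] EuclideanSpace ℂ (Fin (Module.finrank ℂ H)) :=
    decomp.symm.toLinearIsometry.comp ((inrIsometry _ _).comp
      ((pad (N := ℂ) (le_max_right c₀ k)).comp (stdOrthonormalBasis ℂ K).repr.toLinearIsometry))
  obtain ⟨A, -, hrun, hcost⟩ := halg b c le_rfl (le_max_left _ _) _ decomp (fun x => J (ξ x))
    (fun x => J (τ x)) (gram_comp_linearIsometry _ _) (gram_comp_linearIsometry _ _)
  refine ⟨_, A, J, fun x => ⟨hrun x, fun i => ?_⟩⟩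
  have := hκ x i
  rwa [← hcost x i] at this

end Synthesis


/-! ### Feasible solutions -/

section Feasibility

variable {D : Type*} {s : ℕ} {M : Fin s → Type*} [∀ i, NormedAddCommGroup (M i)]
  [∀ i, InnerProductSpace ℂ (M i)] {K : Type*} [NormedAddCommGroup K] [InnerProductSpace ℂ K]

theorem combined_injective :
    Function.Injective (combined : (∀ i, M i →ₗ[ℂ] M i) → PiLp 2 M →ₗ[ℂ] PiLp 2 M) := by
  intro Q Q' h
  ext i v
  have := congrArg (fun f : PiLp 2 M →ₗ[ℂ] PiLp 2 M => f (WithLp.toLp 2 (Pi.single i v)) i) h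
  simpa [combined] using this

theorem inner_oracleGap [∀ i, FiniteDimensional ℂ (M i)] (O : D → ∀ i, M i →ₗ[ℂ] M i) (x y : D)
    {w : ℕ} (v v' : Amp (PiLp 2 M) w) :
    ⟪v, ampMap w (oracleGap O x y) v'⟫_ℂ =
      ⟪v, v'⟫_ℂ - ⟪ampMap w (combined (O x)) v, ampMap w (combined (O y)) v'⟫_ℂ := by
  simp only [inner_amp, ampMap_apply, oracleGap, LinearMap.sub_apply, LinearMap.id_apply,
    LinearMap.comp_apply, inner_sub_right, LinearMap.adjoint_inner_right, Finset.sum_sub_distrib]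

theorem exists_linearIsometryEquiv_combined [∀ i, FiniteDimensional ℂ (M i)]
    (Q : ∀ i, M i →ₗ[ℂ] M i) (hQ : ∀ i, Q i ∈ unitary (M i →ₗ[ℂ] M i)) :
    ∃ u : PiLp 2 M ≃ₗᵢ[ℂ] PiLp 2 M, u.toLinearEquiv.toLinearMap = combined Q := by
  have hnorm : ∀ i v, ‖Q i v‖ = ‖v‖ := by
    intro i v
    have h1 : LinearMap.adjoint (Q i) (Q i v) = v :=
      LinearMap.congr_fun (Unitary.mem_iff.1 (hQ i)).1 v
    rw [← sq_eq_sq₀ (norm_nonneg _) (norm_nonneg _), ← inner_self_eq_norm_sq (𝕜 := ℂ),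
      ← inner_self_eq_norm_sq (𝕜 := ℂ), ← LinearMap.adjoint_inner_right, h1]
  let L : PiLp 2 M →ₗᵢ[ℂ] PiLp 2 M :=
    { toLinearMap := combined Q
      norm_map' := fun v => by
        rw [← sq_eq_sq₀ (norm_nonneg _) (norm_nonneg _), PiLp.norm_sq_eq_of_L2,
          PiLp.norm_sq_eq_of_L2]
        exact Finset.sum_congr rfl fun i _ => by rw [← hnorm i (v i)]; rfl }
  exact ⟨L.toLinearIsometryEquiv rfl, LinearMap.ext fun v => rfl⟩

/-- Extending from the span to all of `K` replaces the dependent domains by a single one. -/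
theorem isLinearlyConsistent_iff (O : D → ∀ i, M i →ₗ[ℂ] M i) (Ks : D → Submodule ℂ K) {w : ℕ}
    (V : ∀ x, Ks x →ₗ[ℂ] Amp (PiLp 2 M) w) :
    IsLinearlyConsistent O Ks V ↔ ∃ L : (∀ i, M i →ₗ[ℂ] M i) → K →ₗ[ℂ] Amp (PiLp 2 M) w,
      ∀ x (ξ : Ks x), L (O x) ξ = V x ξ := by
  constructor
  · intro h
    choose VQ hVQ using h
    choose L hL using fun Q => (VQ Q).exists_extend
    refine ⟨L, fun x ξ => ?_⟩
    rw [← hVQ (O x) x rfl ξ, ← hL]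
    rfl
  · rintro ⟨L, hL⟩ Q
    refine ⟨L Q ∘ₗ Submodule.subtype _, fun x hx ξ => ?_⟩
    subst hx
    exact hL x ξ

theorem isLinearlyConsistent_of_injective {O : D → ∀ i, M i →ₗ[ℂ] M i}
    (hO : Function.Injective O) (Ks : D → Submodule ℂ K) {w : ℕ}
    (V : ∀ x, Ks x →ₗ[ℂ] Amp (PiLp 2 M) w) : IsLinearlyConsistent O Ks V := by
  choose L hL using fun x => (V x).exists_extend
  rw [isLinearlyConsistent_iff]
  refine ⟨Function.extend O L 0, fun x ξ => ?_⟩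
  rw [hO.extend_apply, ← hL]
  rfl

theorem subspaceFeasible_iff [FiniteDimensional ℂ K] [∀ i, FiniteDimensional ℂ (M i)]
    (O : D → ∀ i, M i →ₗ[ℂ] M i) (Ks : D → Submodule ℂ K) (T : ∀ x, Ks x →ₗ[ℂ] K) (w : ℕ)
    (V : ∀ x, Ks x →ₗ[ℂ] Amp (PiLp 2 M) w) :
    SubspaceFeasible O Ks T w V ↔ ∀ x y (ξ : Ks x) (η : Ks y),
      ⟪(ξ : K), (η : K)⟫_ℂ - ⟪T x ξ, T y η⟫_ℂ = ⟪V x ξ, V y η⟫_ℂ -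
        ⟪ampMap w (combined (O x)) (V x ξ), ampMap w (combined (O y)) (V y η)⟫_ℂ := by
  refine forall_congr' fun x => forall_congr' fun y => ?_
  have hl : ∀ (ξ : Ks x) (η : Ks y), ⟪ξ, (LinearMap.adjoint (Ks x).subtype ∘ₗ (Ks y).subtype -
      LinearMap.adjoint (T x) ∘ₗ T y) η⟫_ℂ = ⟪(ξ : K), (η : K)⟫_ℂ - ⟪T x ξ, T y η⟫_ℂ := by
    intro ξ η
    rw [LinearMap.sub_apply, inner_sub_right, LinearMap.comp_apply, LinearMap.comp_apply,
      LinearMap.adjoint_inner_right, LinearMap.adjoint_inner_right]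
    rfl
  have hr : ∀ (ξ : Ks x) (η : Ks y), ⟪ξ, (LinearMap.adjoint (V x) ∘ₗ
      ampMap w (oracleGap O x y) ∘ₗ V y) η⟫_ℂ = ⟪V x ξ, V y η⟫_ℂ -
        ⟪ampMap w (combined (O x)) (V x ξ), ampMap w (combined (O y)) (V y η)⟫_ℂ := by
    intro ξ η
    rw [LinearMap.comp_apply, LinearMap.comp_apply, LinearMap.adjoint_inner_right,
      inner_oracleGap]
  constructor
  · intro h ξ η
    rw [← hl, ← hr, ← h]
  · intro h
    refine LinearMap.ext fun η => ext_inner_left ℂ fun ξ => ?_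
    rw [hl, hr, h]

end Feasibility

/-! ### Suprema over unit vectors -/

section Suprema

variable {E F : Type*} [NormedAddCommGroup E] [InnerProductSpace ℂ E] [FiniteDimensional ℂ E]
  [NormedAddCommGroup F] [InnerProductSpace ℂ F]

/-- For `E = 0` the set is empty and its supremum is `0` by convention, in agreement with the
operator norm. -/
theorem norm_sq_eq_sSup (f : E →ₗ[ℂ] F) :
    ‖LinearMap.toContinuousLinearMap f‖ ^ 2 = sSup {r : ℝ | ∃ v, ‖v‖ = 1 ∧ r = ‖f v‖ ^ 2} := by
  set S := {r : ℝ | ∃ v, ‖v‖ = 1 ∧ r = ‖f v‖ ^ 2} with hS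
  have hle : ∀ r ∈ S, r ≤ ‖LinearMap.toContinuousLinearMap f‖ ^ 2 := by
    rintro r ⟨v, hv, rfl⟩
    gcongr
    simpa [hv] using (LinearMap.toContinuousLinearMap f).le_opNorm v
  have hS0 : 0 ≤ sSup S := Real.sSup_nonneg (by rintro r ⟨v, -, rfl⟩; positivity)
  refine le_antisymm ?_ (Real.sSup_le hle (by positivity))
  have hb : ‖LinearMap.toContinuousLinearMap f‖ ≤ Real.sqrt (sSup S) := by
    refine ContinuousLinearMap.opNorm_le_bound _ (Real.sqrt_nonneg _) fun v => ?_
    change ‖f v‖ ≤ _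
    rcases eq_or_ne v 0 with rfl | hv
    · simp
    · have hv' : ‖v‖ ≠ 0 := norm_ne_zero_iff.2 hv
      have h1 : ‖f (((‖v‖⁻¹ : ℝ) : ℂ) • v)‖ ^ 2 ≤ sSup S :=
        le_csSup ⟨_, hle⟩ ⟨_, by rw [norm_smul]; simp [hv'], rfl⟩
      have h2 := Real.le_sqrt_of_sq_le h1
      rw [map_smul, norm_smul, Complex.norm_real, norm_inv, norm_norm, inv_mul_le_iff₀
        (lt_of_le_of_ne (norm_nonneg _) hv'.symm), mul_comm] at h2
      exact h2
  calc _ ≤ Real.sqrt (sSup S) ^ 2 := by gcongr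
    _ = _ := Real.sq_sqrt hS0

/-- Nonnegativity takes care of the empty set, whose supremum is `0`. -/
theorem abs_sSup_sub_sSup_le {ι : Type*} {P : ι → Prop} {f g : ι → ℝ} {δ : ℝ} (hδ : 0 ≤ δ)
    (hf : ∀ a, 0 ≤ f a) (hg : ∀ a, 0 ≤ g a) (hfg : ∀ a, P a → |f a - g a| ≤ δ)
    (hb : BddAbove {r | ∃ a, P a ∧ r = g a}) :
    |sSup {r | ∃ a, P a ∧ r = f a} - sSup {r | ∃ a, P a ∧ r = g a}| ≤ δ := by
  have key : ∀ f g : ι → ℝ, (∀ a, 0 ≤ g a) → (∀ a, P a → f a ≤ g a + δ) →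
      BddAbove {r | ∃ a, P a ∧ r = g a} →
      sSup {r | ∃ a, P a ∧ r = f a} ≤ sSup {r | ∃ a, P a ∧ r = g a} + δ := by
    intro f g hg hfg hb
    refine Real.sSup_le ?_ (add_nonneg (Real.sSup_nonneg ?_) hδ)
    · rintro r ⟨a, ha, rfl⟩
      exact (hfg a ha).trans (add_le_add_left (le_csSup hb ⟨a, ha, rfl⟩) δ)
    · rintro r ⟨a, -, rfl⟩
      exact hg a
  have h1 := key f g hg (fun a ha => by linarith [(abs_le.1 (hfg a ha)).2]) hb
  have h2 := key g f hf (fun a ha => by linarith [(abs_le.1 (hfg a ha)).1]) (by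
    obtain ⟨B, hB⟩ := hb
    refine ⟨B + δ, ?_⟩
    rintro r ⟨a, ha, rfl⟩
    have := hB ⟨a, ha, rfl⟩
    linarith [(abs_le.1 (hfg a ha)).2])
  rw [abs_le]
  constructor <;> linarith

end Suprema

/-! ### The feasible solution defined by an algorithm -/

section OfAlgorithm

variable {s : ℕ} {M : Fin s → Type*} [∀ i, NormedAddCommGroup (M i)]
  [∀ i, InnerProductSpace ℂ (M i)] {H : Type*} [NormedAddCommGroup H] [InnerProductSpace ℂ H]

/-- All the states processed by the oracle during the execution of the algorithm. -/
def QueryAlgorithm.history (A : QueryAlgorithm (PiLp 2 M) H) (O : PiLp 2 M →ₗ[ℂ] PiLp 2 M) :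
    H →ₗ[ℂ] Amp (PiLp 2 M) (A.T * A.b) where
  toFun ψ := WithLp.toLp 2 fun p =>
    A.queried O (finProdFinEquiv.symm p).1 ψ (finProdFinEquiv.symm p).2
  map_add' u v := by ext p : 1; simp [QueryAlgorithm.queried]
  map_smul' c v := by ext p : 1; simp [QueryAlgorithm.queried]

theorem QueryAlgorithm.history_apply (A : QueryAlgorithm (PiLp 2 M) H)
    (O : PiLp 2 M →ₗ[ℂ] PiLp 2 M) (ψ : H) (p : Fin (A.T * A.b)) :
    A.history O ψ p = A.queried O (finProdFinEquiv.symm p).1 ψ (finProdFinEquiv.symm p).2 := rfl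

theorem QueryAlgorithm.norm_sq_block_history (A : QueryAlgorithm (PiLp 2 M) H)
    (O : ∀ i, M i →ₗ[ℂ] M i) (ψ : H) (i : Fin s) :
    ‖block _ i (A.history (combined O) ψ)‖ ^ 2 = A.complexity O ψ i := by
  rw [QueryAlgorithm.complexity, Finset.sum_range, norm_sq_amp]
  simp only [norm_sq_amp, block_apply, A.history_apply]
  rw [finProdFinEquiv.symm.sum_comp (fun p : Fin A.T × Fin A.b =>
    ‖(A.queried (combined O) p.1 ψ p.2) i‖ ^ 2), Fintype.sum_prod_type]

/-- Inner products of the two runs change only in the queried parts; these changes telescope over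
the queries. -/
theorem QueryAlgorithm.inner_history (A : QueryAlgorithm (PiLp 2 M) H)
    (O O' : PiLp 2 M →ₗ[ℂ] PiLp 2 M) (ψ ψ' : H) :
    ⟪ψ, ψ'⟫_ℂ - ⟪A.run O ψ, A.run O' ψ'⟫_ℂ = ⟪A.history O ψ, A.history O' ψ'⟫_ℂ -
      ⟪ampMap _ O (A.history O ψ), ampMap _ O' (A.history O' ψ')⟫_ℂ := by
  let g : ℕ → ℂ := fun t => ⟪A.stateAt O t ψ, A.stateAt O' t ψ'⟫_ℂ
  have hg : ∀ t, g t - g (t + 1) = ⟪A.queried O t ψ, A.queried O' t ψ'⟫_ℂ -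
      ⟪ampMap _ O (A.queried O t ψ), ampMap _ O' (A.queried O' t ψ')⟫_ℂ := by
    intro t
    have h1 : g t = ⟪A.queried O t ψ, A.queried O' t ψ'⟫_ℂ +
        ⟪(A.decomp (A.stateAt O t ψ)).snd, (A.decomp (A.stateAt O' t ψ')).snd⟫_ℂ := by
      change ⟪A.stateAt O t ψ, A.stateAt O' t ψ'⟫_ℂ = _
      rw [← A.decomp.inner_map_map, WithLp.prod_inner_apply]
      rfl
    have h2 : g (t + 1) = ⟪ampMap _ O (A.queried O t ψ), ampMap _ O' (A.queried O' t ψ')⟫_ℂ +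
        ⟪(A.decomp (A.stateAt O t ψ)).snd, (A.decomp (A.stateAt O' t ψ')).snd⟫_ℂ := by
      change ⟪A.U (t + 1) (A.decomp.symm _), A.U (t + 1) (A.decomp.symm _)⟫_ℂ = _
      rw [LinearIsometryEquiv.inner_map_map, LinearIsometryEquiv.inner_map_map,
        WithLp.prod_inner_apply]
      rfl
    rw [h1, h2]; ring
  have h0 : g 0 = ⟪ψ, ψ'⟫_ℂ := (A.U 0).inner_map_map _ _
  change ⟪ψ, ψ'⟫_ℂ - g A.T = _
  rw [← h0, ← Finset.sum_range_sub', Finset.sum_congr rfl fun t _ => hg t, Finset.sum_range]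
  simp only [inner_amp, ampMap_apply, A.history_apply, Finset.sum_sub_distrib]
  rw [finProdFinEquiv.symm.sum_comp (fun p : Fin A.T × Fin A.b =>
      ⟪A.queried O p.1 ψ p.2, A.queried O' p.1 ψ' p.2⟫_ℂ),
    finProdFinEquiv.symm.sum_comp (fun p : Fin A.T × Fin A.b =>
      ⟪O (A.queried O p.1 ψ p.2), O' (A.queried O' p.1 ψ' p.2)⟫_ℂ),
    Fintype.sum_prod_type, Fintype.sum_prod_type]

/-- The query history depends only on the oracle and linearly on the initial state, so it is
consistent; `inner_history` gives feasibility. -/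
theorem complexitySpace_subset {D : Type*} [∀ i, FiniteDimensional ℂ (M i)] {K : Type*}
    [NormedAddCommGroup K] [InnerProductSpace ℂ K] [FiniteDimensional ℂ K]
    (O : D → ∀ i, M i →ₗ[ℂ] M i) (Ks : D → Submodule ℂ K) (T : ∀ x, Ks x →ₗ[ℂ] K) :
    complexitySpace O Ks T ⊆ consistentObjectiveSpace O Ks T := by
  rintro p ⟨h, A, J, hA, rfl⟩
  let L : (∀ i, M i →ₗ[ℂ] M i) → K →ₗ[ℂ] Amp (PiLp 2 M) (A.T * A.b) :=
    fun Q => A.history (combined Q) ∘ₗ J.toLinearMap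
  refine ⟨A.T * A.b, fun x => L (O x) ∘ₗ (Ks x).subtype, ?_, ?_, ?_⟩
  · rw [subspaceFeasible_iff]
    intro x y ξ η
    have := A.inner_history (combined (O x)) (combined (O y)) (J ξ) (J η)
    rw [hA, hA, J.inner_map_map, J.inner_map_map] at this
    exact this
  · rw [isLinearlyConsistent_iff]
    exact ⟨L, fun x ξ => rfl⟩
  · ext x i
    rw [objective, norm_sq_eq_sSup, profile]
    congr 1
    ext r
    constructor
    · rintro ⟨ξ, hξ, h1, rfl⟩
      exact ⟨⟨ξ, hξ⟩, h1, (A.norm_sq_block_history (O x) (J ξ) i).symm⟩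
    · rintro ⟨ξ, h1, rfl⟩
      exact ⟨ξ, ξ.2, h1, A.norm_sq_block_history (O x) (J ξ) i⟩

end OfAlgorithm


/-! ### Compression of feasible solutions -/

section Compression

/-- The operator `I ⊗ R` from `N ⊗ ℂ^w` to `N ⊗ ℂ^b`. -/
def ampRight {N : Type*} [NormedAddCommGroup N] [InnerProductSpace ℂ N] {w b : ℕ}
    (R : Matrix (Fin b) (Fin w) ℂ) : Amp N w →ₗ[ℂ] Amp N b where
  toFun v := WithLp.toLp 2 fun k => ∑ j, R k j • v j
  map_add' u v := by ext k : 1; simp [Finset.sum_add_distrib]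
  map_smul' c v := by ext k : 1; simp [Finset.smul_sum, smul_comm c]

theorem ampRight_apply {N : Type*} [NormedAddCommGroup N] [InnerProductSpace ℂ N] {w b : ℕ}
    (R : Matrix (Fin b) (Fin w) ℂ) (v : Amp N w) (k : Fin b) :
    ampRight R v k = ∑ j, R k j • v j := rfl

theorem ampRight_ampMap {N : Type*} [NormedAddCommGroup N] [InnerProductSpace ℂ N] {w b : ℕ}
    (R : Matrix (Fin b) (Fin w) ℂ) (A : N →ₗ[ℂ] N) (v : Amp N w) :
    ampMap b A (ampRight R v) = ampRight R (ampMap w A v) := by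
  ext k : 1
  simp [ampRight_apply]

theorem ampRight_block {s : ℕ} {M : Fin s → Type*} [∀ i, NormedAddCommGroup (M i)]
    [∀ i, InnerProductSpace ℂ (M i)] {w b : ℕ} (R : Matrix (Fin b) (Fin w) ℂ) (i : Fin s)
    (v : Amp (PiLp 2 M) w) : block b i (ampRight R v) = ampRight R (block w i v) := by
  ext k : 1
  simp only [block_apply, ampRight_apply, WithLp.ofLp_sum, Finset.sum_apply, PiLp.smul_apply]

/-- Moving `R` across the inner product shows that only `v` has to be fixed by `R^* R`. -/
theorem inner_ampRight {N : Type*} [NormedAddCommGroup N] [InnerProductSpace ℂ N] {w b : ℕ}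
    (R : Matrix (Fin b) (Fin w) ℂ) (u v : Amp N w)
    (h : ampRight R.conjTranspose (ampRight R v) = v) :
    ⟪ampRight R u, ampRight R v⟫_ℂ = ⟪u, v⟫_ℂ := by
  conv_rhs => rw [← h]
  simp only [inner_amp, ampRight_apply, sum_inner, inner_sum, inner_smul_left, inner_smul_right,
    Matrix.conjTranspose_apply, RCLike.star_def]
  conv_rhs => rw [Finset.sum_comm]
  refine Finset.sum_congr rfl fun k _ => ?_
  simp only [Finset.mul_sum]
  rw [Finset.sum_comm]
  exact Finset.sum_congr rfl fun _ _ => Finset.sum_congr rfl fun _ _ => by ring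

theorem norm_block_ampRight {s : ℕ} {M : Fin s → Type*} [∀ i, NormedAddCommGroup (M i)]
    [∀ i, InnerProductSpace ℂ (M i)] {w b : ℕ} (R : Matrix (Fin b) (Fin w) ℂ) (i : Fin s)
    (v : Amp (PiLp 2 M) w) (h : ampRight R.conjTranspose (ampRight R v) = v) :
    ‖block b i (ampRight R v)‖ = ‖block w i v‖ := by
  rw [← sq_eq_sq₀ (norm_nonneg _) (norm_nonneg _), ← inner_self_eq_norm_sq (𝕜 := ℂ),
    ← inner_self_eq_norm_sq (𝕜 := ℂ), ampRight_block, inner_ampRight R]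
  rw [← ampRight_block, ← ampRight_block, h]

/-- A linear family of vectors of `N ⊗ ℂ^w` lives in `N ⊗ U` for a subspace `U` of bounded
dimension. -/
theorem exists_ampRight_conjTranspose {N Z : Type*} [NormedAddCommGroup N]
    [InnerProductSpace ℂ N] [FiniteDimensional ℂ N] [AddCommGroup Z] [Module ℂ Z]
    [FiniteDimensional ℂ Z] {w : ℕ} (V : Z →ₗ[ℂ] Amp N w) :
    ∃ R : Matrix (Fin (Module.finrank ℂ N * Module.finrank ℂ Z)) (Fin w) ℂ,
      ∀ z, ampRight R.conjTranspose (ampRight R (V z)) = V z := by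
  let B := Module.finrank ℂ N * Module.finrank ℂ Z
  let e := (stdOrthonormalBasis ℂ N).repr
  -- The range of `Φ` contains, for every `z`, all coordinate vectors of `V z` in `ℂ^w`.
  let Φ : (Fin (Module.finrank ℂ N) → Z) →ₗ[ℂ] EuclideanSpace ℂ (Fin w) :=
    { toFun := fun ζ => WithLp.toLp 2 fun j => ∑ l, e (V (ζ l) j) l
      map_add' := fun ζ ζ' => by ext j; simp [Finset.sum_add_distrib]
      map_smul' := fun c ζ => by ext j; simp [Finset.mul_sum] }
  let U := LinearMap.range Φ
  let g₀ := stdOrthonormalBasis ℂ U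
  have hd : Module.finrank ℂ U ≤ B := by
    refine (LinearMap.finrank_range_le Φ).trans_eq ?_
    rw [Module.finrank_pi_fintype]
    simp [B]
  let g : Fin B → EuclideanSpace ℂ (Fin w) := fun k =>
    if hk : (k : ℕ) < Module.finrank ℂ U then (g₀ ⟨k, hk⟩ : EuclideanSpace ℂ (Fin w)) else 0
  have hg : ∀ u ∈ U, ∑ k, ⟪g k, u⟫_ℂ • g k = u := by
    intro u hu
    have h1 := congrArg Subtype.val (g₀.sum_repr' ⟨u, hu⟩)
    rw [Submodule.coe_sum] at h1
    refine Eq.trans (Fintype.sum_of_injective (Fin.castLE hd) (Fin.castLE_injective hd) _ _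
      ?_ ?_).symm h1
    · intro k hk
      have : ¬ (k : ℕ) < Module.finrank ℂ U := fun hlt => hk ⟨⟨k, hlt⟩, rfl⟩
      simp [g, this]
    · intro j
      simp [g]
  -- The rows are the conjugates of an orthonormal basis of `U`, padded by zeros, so `R^* R` is the
  -- projection onto `U`.
  refine ⟨Matrix.of fun k j => (starRingEnd ℂ) (g k j), fun z => ?_⟩
  ext j : 1
  apply e.injective
  ext l
  let u : EuclideanSpace ℂ (Fin w) := WithLp.toLp 2 fun j => e (V z j) l
  have hu : u ∈ U := by
    refine ⟨Pi.single l z, ?_⟩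
    ext j
    change ∑ l', e (V ((Pi.single l z : Fin _ → Z) l') j) l' = e (V z j) l
    rw [Finset.sum_eq_single l]
    · simp
    · intro l' _ hl'
      simp [hl']
    · simp
  have h1 := congrArg (fun t : EuclideanSpace ℂ (Fin w) => t j) (hg u hu)
  simp only [WithLp.ofLp_sum, Finset.sum_apply, PiLp.smul_apply, smul_eq_mul] at h1
  change _ = e (V z j) l at h1
  rw [← h1]
  simp only [ampRight_apply, Matrix.conjTranspose_apply, Matrix.of_apply, RCLike.star_def, map_sum,
    map_smul, WithLp.ofLp_sum, Finset.sum_apply, PiLp.smul_apply, smul_eq_mul,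
    PiLp.inner_apply, RCLike.inner_apply, Complex.conj_conj]
  refine Finset.sum_congr rfl fun k _ => ?_
  rw [mul_comm]
  congr 1
  exact Finset.sum_congr rfl fun j' _ => mul_comm _ _

end Compression

/-! ### The objective space of consistent solutions is closed -/

section Closed

variable {D : Type*} {s : ℕ} {M : Fin s → Type*} [∀ i, NormedAddCommGroup (M i)]
  [∀ i, InnerProductSpace ℂ (M i)] [∀ i, FiniteDimensional ℂ (M i)] {K : Type*}
  [NormedAddCommGroup K] [InnerProductSpace ℂ K] [FiniteDimensional ℂ K]

theorem exists_fixed_dimension [Finite D] (O : D → ∀ i, M i →ₗ[ℂ] M i) (Ks : D → Submodule ℂ K)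
    (T : ∀ x, Ks x →ₗ[ℂ] K) :
    ∃ b : ℕ, ∀ p ∈ consistentObjectiveSpace O Ks T, ∃ V : ∀ x, Ks x →ₗ[ℂ] Amp (PiLp 2 M) b,
      SubspaceFeasible O Ks T b V ∧ IsLinearlyConsistent O Ks V ∧ p = objective V := by
  classical
  have := Fintype.ofFinite D
  let b := Module.finrank ℂ (PiLp 2 M) * Module.finrank ℂ (∀ x, Ks x)
  refine ⟨b, ?_⟩
  rintro p ⟨w, V, hV, hc, rfl⟩
  -- Combining all labels into one map yields a single `R`, which therefore preserves the inner
  -- products between different labels.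
  obtain ⟨R, hR⟩ := exists_ampRight_conjTranspose
    (∑ x, V x ∘ₗ LinearMap.proj x : (∀ x, Ks x) →ₗ[ℂ] Amp (PiLp 2 M) w)
  have hR' : ∀ x ξ, ampRight R.conjTranspose (ampRight R (V x ξ)) = V x ξ := by
    intro x ξ
    have h1 := hR (Pi.single x ξ)
    have h2 : (∑ y, V y ∘ₗ LinearMap.proj y : (∀ x, Ks x) →ₗ[ℂ] Amp (PiLp 2 M) w)
        (Pi.single x ξ) = V x ξ := by
      simp only [LinearMap.sum_apply, LinearMap.comp_apply, LinearMap.proj_apply]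
      rw [Finset.sum_eq_single x]
      · simp
      · intro y _ hy
        simp [hy]
      · simp
    rwa [h2] at h1
  refine ⟨fun x => ampRight R ∘ₗ V x, ?_, ?_, ?_⟩
  · rw [subspaceFeasible_iff] at hV ⊢
    intro x y ξ η
    rw [hV x y ξ η]
    simp only [LinearMap.comp_apply, ampRight_ampMap]
    rw [inner_ampRight R _ _ (hR' y η), inner_ampRight R]
    rw [← ampRight_ampMap, ← ampRight_ampMap, hR']
  · rw [isLinearlyConsistent_iff] at hc ⊢
    obtain ⟨L, hL⟩ := hc
    exact ⟨fun Q => ampRight R ∘ₗ L Q, fun x ξ => by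
      change ampRight R (L (O x) ξ) = ampRight R (V x ξ)
      rw [hL]⟩
  · ext x i
    rw [objective, objective, norm_sq_eq_sSup, norm_sq_eq_sSup]
    congr 1
    ext r
    refine exists_congr fun ξ => and_congr_right fun _ => ?_
    have : ‖block w i (V x ξ)‖ = ‖block b i (ampRight R (V x ξ))‖ :=
      (norm_block_ampRight R i _ (hR' x ξ)).symm
    simp only [LinearMap.comp_apply]
    rw [this]

omit [∀ i, FiniteDimensional ℂ (M i)] in
theorem norm_sq_eq_sum_block {w : ℕ} (v : Amp (PiLp 2 M) w) :
    ‖v‖ ^ 2 = ∑ i, ‖block w i v‖ ^ 2 := by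
  simp only [norm_sq_amp, block_apply]
  rw [Finset.sum_comm]
  exact Finset.sum_congr rfl fun j _ => PiLp.norm_sq_eq_of_L2 _ _

omit [∀ i, FiniteDimensional ℂ (M i)] in
theorem norm_sq_le_sum_objective {Ks : D → Submodule ℂ K} {w : ℕ}
    (V : ∀ x, Ks x →L[ℂ] Amp (PiLp 2 M) w) (x : D) :
    ‖V x‖ ^ 2 ≤ ∑ i, objective (fun x => (V x : Ks x →ₗ[ℂ] Amp (PiLp 2 M) w)) x i := by
  set B := ∑ i, objective (fun x => (V x : Ks x →ₗ[ℂ] Amp (PiLp 2 M) w)) x i with hB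
  have h0 : 0 ≤ B := Finset.sum_nonneg fun i _ => by
    rw [objective]; positivity
  have hb : ‖V x‖ ≤ Real.sqrt B := by
    refine ContinuousLinearMap.opNorm_le_bound _ (Real.sqrt_nonneg _) fun ξ => ?_
    rw [← sq_le_sq₀ (norm_nonneg _) (by positivity), mul_pow, Real.sq_sqrt h0, hB,
      Finset.sum_mul, norm_sq_eq_sum_block]
    refine Finset.sum_le_sum fun i _ => ?_
    rw [objective, ← mul_pow]
    gcongr
    exact (LinearMap.toContinuousLinearMap
      (block w i ∘ₗ (V x : Ks x →ₗ[ℂ] Amp (PiLp 2 M) w))).le_opNorm ξ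
  calc ‖V x‖ ^ 2 ≤ Real.sqrt B ^ 2 := by gcongr
    _ = B := Real.sq_sqrt h0

theorem continuous_norm_sq_comp {E F G : Type*} [NormedAddCommGroup E] [NormedSpace ℂ E]
    [NormedAddCommGroup F] [NormedSpace ℂ F] [NormedAddCommGroup G] [NormedSpace ℂ G]
    (P : F →L[ℂ] G) : Continuous fun V : E →L[ℂ] F => ‖P.comp V‖ ^ 2 := by
  have h : Continuous fun V : E →L[ℂ] F => P.comp V := continuous_const.clm_comp continuous_id
  exact h.norm.pow 2

theorem continuous_objective {Ks : D → Submodule ℂ K} {w : ℕ} :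
    Continuous fun V : ∀ x, Ks x →L[ℂ] Amp (PiLp 2 M) w =>
      objective fun x => (V x : Ks x →ₗ[ℂ] Amp (PiLp 2 M) w) := by
  refine continuous_pi fun x => continuous_pi fun i => ?_
  let P : Amp (PiLp 2 M) w →L[ℂ] Amp (M i) w := LinearMap.toContinuousLinearMap (block w i)
  have h : ∀ V : ∀ x, Ks x →L[ℂ] Amp (PiLp 2 M) w,
      objective (fun x => (V x : Ks x →ₗ[ℂ] Amp (PiLp 2 M) w)) x i = ‖P.comp (V x)‖ ^ 2 := by
    intro V
    rw [objective]
    congr 2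
  simp only [h]
  exact (continuous_norm_sq_comp P).comp (continuous_apply x)

/-- The estimate makes `f` proper on `C`: preimages of a convergent sequence are bounded and
subconverge in finite dimension. -/
theorem isClosed_image_of_norm_sq_le {E : D → Type*} {G Y : Type*} [Finite D]
    [∀ x, NormedAddCommGroup (E x)] [∀ x, NormedSpace ℂ (E x)]
    [∀ x, FiniteDimensional ℂ (E x)] [NormedAddCommGroup G] [NormedSpace ℂ G]
    [FiniteDimensional ℂ G] [NormedAddCommGroup Y] {C : Set (∀ x, E x →L[ℂ] G)}
    (hC : IsClosed C) {f : (∀ x, E x →L[ℂ] G) → Y} (hf : Continuous f) {a : ℝ} (ha : 0 ≤ a)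
    (h : ∀ V ∈ C, ∀ x, ‖V x‖ ^ 2 ≤ a * ‖f V‖) : IsClosed (f '' C) := by
  have := Fintype.ofFinite D
  have hproper : ProperSpace (∀ x, E x →L[ℂ] G) := FiniteDimensional.proper ℂ _
  refine IsSeqClosed.isClosed fun p p₀ hp hlim => ?_
  choose V hVC hVp using hp
  obtain ⟨B, hB⟩ := (Metric.isBounded_range_of_tendsto p hlim).exists_norm_le
  have hbound : ∀ n, V n ∈ Metric.closedBall 0 (Real.sqrt (a * B)) := by
    intro n
    rw [mem_closedBall_zero_iff, pi_norm_le_iff_of_nonneg (Real.sqrt_nonneg _)]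
    intro x
    refine Real.le_sqrt_of_sq_le ((h _ (hVC n) x).trans ?_)
    rw [hVp]
    exact mul_le_mul_of_nonneg_left (hB _ ⟨n, rfl⟩) ha
  obtain ⟨V₀, -, φ, hφ, hφlim⟩ := tendsto_subseq_of_bounded Metric.isBounded_closedBall hbound
  refine ⟨V₀, hC.mem_of_tendsto hφlim (.of_forall fun n => hVC _), ?_⟩
  refine tendsto_nhds_unique ((hf.tendsto V₀).comp hφlim) ?_
  have : f ∘ V ∘ φ = p ∘ φ := funext fun n => hVp _
  rw [this]
  exact hlim.comp hφ.tendsto_atTop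

/-- The consistent families of maps form a subspace. -/
def consistentSubmodule (O : D → ∀ i, M i →ₗ[ℂ] M i) (Ks : D → Submodule ℂ K) (w : ℕ) :
    Submodule ℂ (∀ x, Ks x →L[ℂ] Amp (PiLp 2 M) w) where
  carrier := {V | IsLinearlyConsistent O Ks fun x => (V x : Ks x →ₗ[ℂ] Amp (PiLp 2 M) w)}
  zero_mem' := (isLinearlyConsistent_iff _ _ _).2 ⟨0, fun _ _ => rfl⟩
  add_mem' := by
    intro V V' h h'
    obtain ⟨L, hL⟩ := (isLinearlyConsistent_iff _ _ _).1 h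
    obtain ⟨L', hL'⟩ := (isLinearlyConsistent_iff _ _ _).1 h'
    exact (isLinearlyConsistent_iff _ _ _).2 ⟨L + L', fun x ξ => by
      change L (O x) ξ + L' (O x) ξ = V x ξ + V' x ξ
      rw [hL, hL']; rfl⟩
  smul_mem' := by
    intro c V h
    obtain ⟨L, hL⟩ := (isLinearlyConsistent_iff _ _ _).1 h
    exact (isLinearlyConsistent_iff _ _ _).2 ⟨c • L, fun x ξ => by
      change c • L (O x) ξ = c • V x ξ
      rw [hL]; rfl⟩

theorem isClosed_consistentObjectiveSpace [Finite D] (O : D → ∀ i, M i →ₗ[ℂ] M i)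
    (Ks : D → Submodule ℂ K) (T : ∀ x, Ks x →ₗ[ℂ] K) :
    IsClosed (consistentObjectiveSpace O Ks T) := by
  have := Fintype.ofFinite D
  obtain ⟨b, hb⟩ := exists_fixed_dimension O Ks T
  let F := ∀ x, Ks x →L[ℂ] Amp (PiLp 2 M) b
  let obj : F → D → Fin s → ℝ := fun V => objective fun x => (V x : Ks x →ₗ[ℂ] Amp (PiLp 2 M) b)
  let C : Set F := {V | SubspaceFeasible O Ks T b fun x => (V x : Ks x →ₗ[ℂ] Amp (PiLp 2 M) b)} ∩
    (consistentSubmodule O Ks b : Set F)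
  have hobj : Continuous obj := continuous_objective
  have hC : IsClosed C := by
    refine IsClosed.inter ?_ (Submodule.closed_of_finiteDimensional _)
    simp only [subspaceFeasible_iff, Set.ofPred_forall]
    refine isClosed_iInter fun x => isClosed_iInter fun y => isClosed_iInter fun ξ =>
      isClosed_iInter fun η => isClosed_eq continuous_const ?_
    have h1 : ∀ x (ξ : Ks x), Continuous fun V : F => V x ξ := fun x ξ =>
      (continuous_apply x).clm_apply continuous_const
    have h2 : ∀ x (ξ : Ks x), Continuous fun V : F => ampMap b (combined (O x)) (V x ξ) :=
      fun x ξ => (LinearMap.continuous_of_finiteDimensional _).comp (h1 x ξ)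
    exact ((h1 x ξ).inner (h1 y η)).sub ((h2 x ξ).inner (h2 y η))
  have himage : consistentObjectiveSpace O Ks T = obj '' C := by
    ext p
    constructor
    · intro hp
      obtain ⟨V, hV, hc, rfl⟩ := hb p hp
      exact ⟨fun x => LinearMap.toContinuousLinearMap (V x), ⟨hV, hc⟩, rfl⟩
    · rintro ⟨V, ⟨hV, hc⟩, rfl⟩
      exact ⟨b, _, hV, hc, rfl⟩
  rw [himage]
  refine isClosed_image_of_norm_sq_le hC hobj (Nat.cast_nonneg s) fun V _ x => ?_
  refine (norm_sq_le_sum_objective V x).trans ?_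
  have : ∀ i ∈ Finset.univ, obj V x i ≤ ‖obj V‖ := fun i _ =>
    (Real.le_norm_self _).trans ((norm_le_pi_norm (obj V x) i).trans (norm_le_pi_norm (obj V) x))
  simpa using Finset.sum_le_card_nsmul _ _ _ this

end Closed


/-! ### Algorithms from feasible solutions -/

section Main

variable {D : Type*} {s : ℕ} {M : Fin s → Type*} [∀ i, NormedAddCommGroup (M i)]
  [∀ i, InnerProductSpace ℂ (M i)] {K : Type*} [NormedAddCommGroup K] [InnerProductSpace ℂ K]

theorem exists_linearMap_of_linearIndependent {ι E F : Type*} [AddCommGroup E] [Module ℂ E]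
    [AddCommGroup F] [Module ℂ F] {v : ι → E} (hv : LinearIndependent ℂ v) (f : ι → F) :
    ∃ L : E →ₗ[ℂ] F, ∀ i, L (v i) = f i := by
  obtain ⟨L, hL⟩ := ((Module.Basis.span hv).constr ℂ f).exists_extend
  refine ⟨L, fun i => ?_⟩
  rw [← (Module.Basis.span hv).constr_basis ℂ f i, ← hL, LinearMap.comp_apply,
    Submodule.subtype_apply, Module.Basis.span_apply]

theorem LinIndepAssumption.exists_isLinearExtension {E : Type*} [AddCommGroup E] [Module ℂ E]
    {O : D → ∀ i, M i →ₗ[ℂ] M i} {ξ : D → K} (h : LinIndepAssumption O ξ) (η : D → E) :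
    ∃ L : ∀ Q, stateSpan O ξ Q →ₗ[ℂ] E, IsLinearExtension O ξ η L := by
  choose L hL using fun Q => exists_linearMap_of_linearIndependent (h Q)
    (fun x : {x : D // O x = Q} => η x)
  exact ⟨fun Q => L Q ∘ₗ (stateSpan O ξ Q).subtype, fun x => hL (O x) ⟨x, rfl⟩⟩

/-- Covers the operators `Q` that are not among the oracles and need not be unitary. -/
theorem eq_zero_of_mem_stateSpan {O : D → ∀ i, M i →ₗ[ℂ] M i} {ξ : D → K}
    {Q : ∀ i, M i →ₗ[ℂ] M i} (hQ : Q ∉ Set.range O) (ψ : stateSpan O ξ Q) : ψ = 0 := by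
  have h : {u | ∃ x, O x = Q ∧ ξ x = u} = ∅ :=
    Set.eq_empty_of_forall_notMem fun u ⟨x, hx, _⟩ => hQ ⟨x, hx⟩
  have h2 : (ψ : K) ∈ Submodule.span ℂ {u | ∃ x, O x = Q ∧ ξ x = u} := ψ.2
  rw [h, Submodule.span_empty, Submodule.mem_bot] at h2
  exact Subtype.ext h2

/-- The adversary constraints extend from the given vectors to their spans. -/
theorem AdversaryFeasible.extend [∀ i, FiniteDimensional ℂ (M i)]
    {O : D → ∀ i, M i →ₗ[ℂ] M i} {ξ τ : D → K} {w : ℕ} {v : D → Amp (PiLp 2 M) w}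
    (h : AdversaryFeasible O ξ τ w v) {T : ∀ Q, stateSpan O ξ Q →ₗ[ℂ] K}
    {V : ∀ Q, stateSpan O ξ Q →ₗ[ℂ] Amp (PiLp 2 M) w} (hT : IsLinearExtension O ξ τ T)
    (hV : IsLinearExtension O ξ v V) (Q Q' : ∀ i, M i →ₗ[ℂ] M i) (ψ : stateSpan O ξ Q)
    (ψ' : stateSpan O ξ Q') :
    ⟪(ψ : K), (ψ' : K)⟫_ℂ - ⟪T Q ψ, T Q' ψ'⟫_ℂ = ⟪V Q ψ, V Q' ψ'⟫_ℂ -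
      ⟪ampMap w (combined Q) (V Q ψ), ampMap w (combined Q') (V Q' ψ')⟫_ℂ := by
  obtain ⟨ψ, hψ⟩ := ψ
  obtain ⟨ψ', hψ'⟩ := ψ'
  induction hψ using Submodule.span_induction with
  | mem u hu =>
    obtain ⟨x, rfl, rfl⟩ := hu
    induction hψ' using Submodule.span_induction with
    | mem u' hu' =>
      obtain ⟨y, rfl, rfl⟩ := hu'
      have := h x y
      rw [inner_oracleGap] at this
      rw [hT x, hT y, hV x, hV y]
      exact this
    | zero =>
      have h0 : (⟨0, zero_mem _⟩ : stateSpan O ξ Q') = 0 := rfl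
      simp only [h0, map_zero, inner_zero_right, sub_zero]
    | add a b ha hb iha ihb =>
      have h0 : (⟨a + b, add_mem ha hb⟩ : stateSpan O ξ Q') = ⟨a, ha⟩ + ⟨b, hb⟩ := rfl
      simp only [h0, map_add, inner_add_right] at iha ihb ⊢
      linear_combination iha + ihb
    | smul c a ha iha =>
      have h0 : (⟨c • a, Submodule.smul_mem _ c ha⟩ : stateSpan O ξ Q') = c • ⟨a, ha⟩ := rfl
      simp only [h0, map_smul, inner_smul_right] at iha ⊢
      linear_combination c * iha
  | zero =>
    have h0 : (⟨0, zero_mem _⟩ : stateSpan O ξ Q) = 0 := rfl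
    simp only [h0, map_zero, inner_zero_left, sub_zero]
  | add a b ha hb iha ihb =>
    have h0 : (⟨a + b, add_mem ha hb⟩ : stateSpan O ξ Q) = ⟨a, ha⟩ + ⟨b, hb⟩ := rfl
    simp only [h0, map_add, inner_add_left] at iha ihb ⊢
    linear_combination iha + ihb
  | smul c a ha iha =>
    have h0 : (⟨c • a, Submodule.smul_mem _ c ha⟩ : stateSpan O ξ Q) = c • ⟨a, ha⟩ := rfl
    simp only [h0, map_smul, inner_smul_left] at iha ⊢
    linear_combination (starRingEnd ℂ c) * iha

/-- Exact state conversion for an arbitrary family of states which depends linearly on the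
initial state for every oracle. -/
theorem exists_algorithm_of_feasible [Finite D] [∀ i, FiniteDimensional ℂ (M i)]
    [FiniteDimensional ℂ K] {O : D → ∀ i, M i →ₗ[ℂ] M i}
    (hO : ∀ x i, O x i ∈ unitary (M i →ₗ[ℂ] M i)) {X : Type*} (o : X → Set.range O)
    (ξ τ : X → K) {w : ℕ} (v : X → Amp (PiLp 2 M) w)
    (h : ∀ x y, ⟪ξ x, ξ y⟫_ℂ - ⟪τ x, τ y⟫_ℂ = ⟪v x, v y⟫_ℂ -
      ⟪ampMap w (combined (o x : ∀ i, M i →ₗ[ℂ] M i)) (v x), ampMap w (combined (o y).1) (v y)⟫_ℂ)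
    (L : (∀ i, M i →ₗ[ℂ] M i) → K →ₗ[ℂ] Amp (PiLp 2 M) w) (hL : ∀ x, L (o x) (ξ x) = v x)
    {δ : ℝ} (hδ : 0 < δ) :
    ∃ (d : ℕ) (A : QueryAlgorithm (PiLp 2 M) (EuclideanSpace ℂ (Fin d)))
      (J : K →ₗᵢ[ℂ] EuclideanSpace ℂ (Fin d)),
      ∀ x, A.run (combined (o x : ∀ i, M i →ₗ[ℂ] M i)) (J (ξ x)) = J (τ x) ∧
        ∀ i, |A.complexity (o x : ∀ i, M i →ₗ[ℂ] M i) (J (ξ x)) i - ‖block w i (v x)‖ ^ 2| ≤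
          δ * ‖ξ x‖ ^ 2 := by
  have hunit : ∀ Q : Set.range O, ∃ u : PiLp 2 M ≃ₗᵢ[ℂ] PiLp 2 M,
      u.toLinearEquiv.toLinearMap = combined (Q : ∀ i, M i →ₗ[ℂ] M i) := by
    rintro ⟨_, x, rfl⟩
    exact exists_linearIsometryEquiv_combined _ (hO x)
  choose u hu using hunit
  have huinj : Function.Injective u := fun Q Q' hQ =>
    Subtype.ext (combined_injective (by rw [← hu, ← hu, hQ]))
  have hcat : Catalyzes (fun x => u (o x)) ξ τ v := by
    ext x y
    have h1 := h x y
    rw [← hu, ← hu] at h1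
    change ⟪ξ x, ξ y⟫_ℂ + ⟪ampMap w (u (o x)).toLinearEquiv.toLinearMap (v x),
      ampMap w (u (o y)).toLinearEquiv.toLinearMap (v y)⟫_ℂ = ⟪τ x, τ y⟫_ℂ + ⟪v x, v y⟫_ℂ
    linear_combination h1
  obtain ⟨d, A, J, hA⟩ := hcat.exists_algorithm o u huinj (fun Q => L Q) hL hδ
  refine ⟨d, A, J, fun x => ?_⟩
  have := hA x
  rw [oracleMap, hu] at this
  exact this

/-- Taking all pairs of a label and a vector of its subspace as indices gives an error uniform over
unit vectors, which passes to the suprema. -/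
theorem consistentObjectiveSpace_subset_closure [Finite D] [∀ i, FiniteDimensional ℂ (M i)]
    [FiniteDimensional ℂ K] {O : D → ∀ i, M i →ₗ[ℂ] M i}
    (hO : ∀ x i, O x i ∈ unitary (M i →ₗ[ℂ] M i)) (Ks : D → Submodule ℂ K)
    (T : ∀ x, Ks x →ₗ[ℂ] K) :
    consistentObjectiveSpace O Ks T ⊆ closure (complexitySpace O Ks T) := by
  have := Fintype.ofFinite D
  rintro p ⟨w, V, hV, hc, rfl⟩
  rw [subspaceFeasible_iff] at hV
  obtain ⟨L, hL⟩ := (isLinearlyConsistent_iff _ _ _).1 hc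
  rw [Metric.mem_closure_iff]
  intro ε hε
  obtain ⟨d, A, J, hA⟩ := exists_algorithm_of_feasible hO
    (X := Σ x, Ks x) (fun x => ⟨O x.1, x.1, rfl⟩) (fun x => x.2) (fun x => T x.1 x.2)
    (fun x => V x.1 x.2) (fun x y => hV x.1 y.1 x.2 y.2) L (fun x => hL x.1 x.2) (half_pos hε)
  refine ⟨profile A J O Ks, ⟨d, A, J, fun x ξ => (hA ⟨x, ξ⟩).1, rfl⟩, ?_⟩
  refine lt_of_le_of_lt ?_ (half_lt_self hε)
  rw [dist_comm, dist_pi_le_iff (half_pos hε).le]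
  intro x
  rw [dist_pi_le_iff (half_pos hε).le]
  intro i
  have hprofile : profile A J O Ks x i =
      sSup {r : ℝ | ∃ ξ : Ks x, ‖ξ‖ = 1 ∧ r = A.complexity (O x) (J ξ) i} := by
    rw [profile]
    congr 1
    ext r
    constructor
    · rintro ⟨ξ, hξ, h1, rfl⟩
      exact ⟨⟨ξ, hξ⟩, h1, rfl⟩
    · rintro ⟨ξ, h1, rfl⟩
      exact ⟨ξ, ξ.2, h1, rfl⟩
  rw [Real.dist_eq, hprofile, objective, norm_sq_eq_sSup]
  refine abs_sSup_sub_sSup_le (half_pos hε).le (fun ξ => ?_) (fun ξ => by positivity)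
    (fun ξ hξ => ?_) ⟨‖LinearMap.toContinuousLinearMap (block w i ∘ₗ V x)‖ ^ 2, ?_⟩
  · exact Finset.sum_nonneg fun t _ => by positivity
  · have h1 := (hA ⟨x, ξ⟩).2 i
    have h2 : ‖(ξ : K)‖ = 1 := hξ
    rw [h2, one_pow, mul_one] at h1
    exact h1
  · rintro r ⟨ξ, hξ, rfl⟩
    gcongr
    simpa [hξ] using (LinearMap.toContinuousLinearMap (block w i ∘ₗ V x)).le_opNorm ξ

end Main

end LasVegas

end

theorem mainTheorem6 {D : Type*} [Finite D] {s : ℕ} {M : Fin s → Type*}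
    [∀ i, NormedAddCommGroup (M i)] [∀ i, InnerProductSpace ℂ (M i)]
    [∀ i, FiniteDimensional ℂ (M i)] {K : Type*} [NormedAddCommGroup K]
    [InnerProductSpace ℂ K] [FiniteDimensional ℂ K]
    (O : D → ∀ i, M i →ₗ[ℂ] M i) (hO : ∀ x i, O x i ∈ unitary (M i →ₗ[ℂ] M i)) :
    -- state conversion under the linear independence assumption
    (∀ (ξ τ : D → K) (w : ℕ) (v : D → Amp (PiLp 2 M) w),
      LinIndepAssumption O ξ → AdversaryFeasible O ξ τ w v →
      (∃ T : ∀ Q, stateSpan O ξ Q →ₗ[ℂ] K, IsLinearExtension O ξ τ T) ∧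
      (∃ V : ∀ Q, stateSpan O ξ Q →ₗ[ℂ] Amp (PiLp 2 M) w, IsLinearExtension O ξ v V) ∧
      ∀ (T : ∀ Q, stateSpan O ξ Q →ₗ[ℂ] K)
        (V : ∀ Q, stateSpan O ξ Q →ₗ[ℂ] Amp (PiLp 2 M) w),
        IsLinearExtension O ξ τ T → IsLinearExtension O ξ v V →
        ∀ δ : ℝ, 0 < δ →
          ∃ (h : ℕ) (A : QueryAlgorithm (PiLp 2 M) (EuclideanSpace ℂ (Fin h)))
            (J : K →ₗᵢ[ℂ] EuclideanSpace ℂ (Fin h)),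
            ∀ (Q : ∀ i, M i →ₗ[ℂ] M i) (ψ : stateSpan O ξ Q),
              A.run (combined Q) (J ψ) = J (T Q ψ) ∧
              ∀ i, |A.complexity Q (J ψ) i - ‖block w i (V Q ψ)‖ ^ 2| ≤ δ * ‖ψ‖ ^ 2) ∧
    -- isometric subspace conversion
    (∀ (Ks : D → Submodule ℂ K) (T : ∀ x, Ks x →ₗᵢ[ℂ] K),
      closure (complexitySpace O Ks (fun x => (T x).toLinearMap)) =
        consistentObjectiveSpace O Ks (fun x => (T x).toLinearMap) ∧
      (Function.Injective O →
        closure (complexitySpace O Ks (fun x => (T x).toLinearMap)) =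
          objectiveSpace O Ks (fun x => (T x).toLinearMap))) := by
  refine ⟨fun ξ τ w v hli hadv => ⟨hli.exists_isLinearExtension τ, hli.exists_isLinearExtension v,
    fun T V hT hV δ hδ => ?_⟩, fun Ks T => ?_⟩
  · choose L hL using fun Q => (V Q).exists_extend
    -- The index set is the disjoint union of the spans over the distinct oracles, so one algorithm
    -- serves every initial state.
    obtain ⟨d, A, J, hA⟩ := exists_algorithm_of_feasible hO
      (X := Σ Q : Set.range O, stateSpan O ξ Q) (fun x => x.1) (fun x => x.2)
      (fun x => T x.1 x.2) (fun x => V x.1 x.2)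
      (fun x y => hadv.extend hT hV x.1 y.1 x.2 y.2) L (fun x => by rw [← hL]; rfl) hδ
    refine ⟨d, A, J, fun Q ψ => ?_⟩
    by_cases hQ : Q ∈ Set.range O
    · exact hA ⟨⟨Q, hQ⟩, ψ⟩
    · rw [eq_zero_of_mem_stateSpan hQ ψ]
      refine ⟨by simp, fun i => ?_⟩
      rw [← A.norm_sq_block_history]
      simp
  · have h : closure (complexitySpace O Ks (fun x => (T x).toLinearMap)) =
        consistentObjectiveSpace O Ks (fun x => (T x).toLinearMap) :=
      (closure_minimal (complexitySpace_subset _ _ _)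
        (isClosed_consistentObjectiveSpace _ _ _)).antisymm
        (consistentObjectiveSpace_subset_closure hO _ _)
    refine ⟨h, fun hinj => h.trans ?_⟩
    ext p
    exact exists_congr fun w => exists_congr fun V =>
      ⟨fun ⟨h1, _, h3⟩ => ⟨h1, h3⟩,
        fun ⟨h1, h3⟩ => ⟨h1, isLinearlyConsistent_of_injective hinj Ks V, h3⟩⟩
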